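/- **Theorem.** An instance of the $k$-Median problem consists of a finite set $U$ of centers, a finite set $W$ of $n=|W|$ customers, a set of edges $E\subseteq U\times W$, a cost $c_{ij}\in[0,\infty)$ for each $(i,j)\in E$ (put $c_{ij}=\infty$ for $(i,j)\notin E$), and an integer $k$. Assume $2\le k\le n/3$. Let $\lambda^*\in[0,\infty]$ be the optimum value of the linear program $$\text{minimize } \sum_{i\in U,\,j\in W} c_{ij}\,y_{ij}\quad\text{subject to}\quad x_i\ge y_{ij}\ge 0\ (i\in U,\ j\in W),\quad \sum_{i\in U} y_{ij}=1\ (j\in W),\quad \sum_{i\in U}x_i=k,$$ with the convention $\infty\cdot 0=0$, and with $\lambda^*=\infty$ if no feasible solution has finite cost. For $\lambda\in[0,\infty]$ and $C\subseteq U$, the *capped cost* of $C$ is $$\tilde c(\lambda,C)=\sum_{j\in W}\min\Big(\frac1{2k+1},\ \Big(1-\frac{2k}{n}\Big)\frac{\min_{i\in C}c_{ij}}{\lambda}\Big),$$ where $0/0=\infty/\infty=0$, $a/0=\infty$ for $a>0$, and a minimum over the empty set is $\infty$. Let $$T=\Big\lceil k\,\ln\frac{n^2}{2k(2k+1)}\Big\rceil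 .$$ Then, given the instance, a set $C\subseteq U$ of at most $T$ centers with $\tilde c(\lambda^*,C)<1$ can be computed in polynomial time. Here polynomial time is meant in the following (strong) sense. There is one random-access program, using arithmetic operations and comparisons on natural and on real numbers, and one polynomial $p$, such that on every instance with real costs as above the program halts with such a set $C$ after at most $p(|U|+|W|)$ elementary operations, storing only natural numbers of at most $p(|U|+|W|)$ bits; and if all costs are rational numbers of at most $L$ bits each, then all real numbers that the program stores are rational numbers of at most $p(|U|+|W|+L)$ bits. -/

import Mathlib

open scoped ENNReal NNReal

/-! ### The `k`-Median problem -/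

namespace KMedian

/-- A `k`-Median instance: a bipartite graph with centers `U = Fin nU`, customers `W = Fin nW`
and edge set `E ⊆ U × W`, nonnegative real assignment costs on the edges, and the integer `k`.
The values of `cost` off `E` play no role anywhere. -/
structure Instance where
  nU : ℕ
  nW : ℕ
  k : ℕ
  E : Finset (Fin nU × Fin nW)
  cost : Fin nU → Fin nW → ℝ≥0

/-- The extended cost `c i j`, which is `∞` when `(i, j)` is not an edge. -/
noncomputable def Instance.c (I : Instance) (i : Fin I.nU) (j : Fin I.nW) : ℝ≥0∞ :=
  if (i, j) ∈ I.E then (I.cost i j : ℝ≥0∞) else ⊤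

/-- Feasibility of `(x, y)` for the standard linear-program relaxation:
`x i ≥ y i j ≥ 0`, `∑ i, y i j = 1` for every customer `j`, and `∑ i, x i = k`. -/
structure LPFeasible (I : Instance) (x : Fin I.nU → ℝ) (y : Fin I.nU → Fin I.nW → ℝ) : Prop where
  nonneg : ∀ i j, 0 ≤ y i j
  le : ∀ i j, y i j ≤ x i
  assign : ∀ j, ∑ i, y i j = 1
  size : ∑ i, x i = (I.k : ℝ)

/-- The objective `∑ i j, c i j * y i j` of the linear program (with `∞ * 0 = 0`). -/
noncomputable def lpCost (I : Instance) (y : Fin I.nU → Fin I.nW → ℝ) : ℝ≥0∞ :=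
  ∑ i, ∑ j, I.c i j * ENNReal.ofReal (y i j)

/-- The optimum cost `λ*` of the linear program, an element of `[0, ∞]`
(it is `∞` when no feasible solution has finite cost). -/
noncomputable def lpOpt (I : Instance) : ℝ≥0∞ :=
  sInf {v | ∃ x y, LPFeasible I x y ∧ v = lpCost I y}

/-- The capped cost of customer `j`,
`min (1 / (2k+1)) ((1 - 2k/n) * min_{i ∈ C} c i j / lam)`.
Division in `[0, ∞]` has `0 / 0 = ∞ / ∞ = 0` and `a / 0 = ∞` for `a > 0`, and the minimum over
`C = ∅` is `∞`. -/
noncomputable def cappedCostAt (I : Instance) (lam : ℝ≥0∞) (C : Finset (Fin I.nU))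
    (j : Fin I.nW) : ℝ≥0∞ :=
  min (ENNReal.ofReal (1 / (2 * (I.k : ℝ) + 1)))
    (ENNReal.ofReal (1 - 2 * (I.k : ℝ) / (I.nW : ℝ)) * (⨅ i ∈ C, I.c i j) / lam)

/-- The capped cost of the set `C` of centers. -/
noncomputable def cappedCost (I : Instance) (lam : ℝ≥0∞) (C : Finset (Fin I.nU)) : ℝ≥0∞ :=
  ∑ j, cappedCostAt I lam C j

/-- `T = ⌈k ln (n² / (2k(2k+1)))⌉`, where `n` is the number of customers. -/
noncomputable def firstPhaseSize (I : Instance) : ℕ :=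
  ⌈(I.k : ℝ) * Real.log ((I.nW : ℝ) ^ 2 / (2 * (I.k : ℝ) * (2 * (I.k : ℝ) + 1)))⌉₊

end KMedian

/-! ### The machine model

A random-access machine over the reals.  The memory consists of arrays of natural numbers and
arrays of real numbers; each program mentions only finitely many arrays, by constant names, and
accesses their cells by computed indices.  The machine does arithmetic and comparisons on both
kinds of numbers; it has no real constants, no rounding, and no way to turn a real number into a
natural number other than by branching on comparisons. -/

namespace RAM

/-- Memory: `s.int a p` is cell `p` of the `a`-th array of naturals,
`s.real a p` is cell `p` of the `a`-th array of reals. -/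
structure State where
  int : ℕ → ℕ → ℕ
  real : ℕ → ℕ → ℝ

/-- Expressions of natural-number type. -/
inductive IntExp where
  | const (v : ℕ)
  | get (a : ℕ) (p : IntExp)
  | add (e f : IntExp)
  | sub (e f : IntExp)
  | mul (e f : IntExp)

/-- Expressions of real type. -/
inductive RealExp where
  | cast (e : IntExp)
  | get (a : ℕ) (p : IntExp)
  | add (e f : RealExp)
  | sub (e f : RealExp)
  | mul (e f : RealExp)
  | div (e f : RealExp)

/-- Tests. -/
inductive Test where
  | intLe (e f : IntExp)
  | realLe (e f : RealExp)
  | not (b : Test)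
  | and (b b' : Test)

/-- Programs. -/
inductive Prog where
  | skip
  | setInt (a : ℕ) (p : IntExp) (e : IntExp)
  | setReal (a : ℕ) (p : IntExp) (e : RealExp)
  | seq (c d : Prog)
  | ite (b : Test) (c d : Prog)
  | while (b : Test) (c : Prog)

/-- Value of an integer expression (subtraction is truncated at zero). -/
def IntExp.eval (s : State) : IntExp → ℕ
  | const v => v
  | get a p => s.int a (p.eval s)
  | add e f => e.eval s + f.eval s
  | sub e f => e.eval s - f.eval s
  | mul e f => e.eval s * f.eval s

/-- Value of a real expression (division by zero yields zero). -/
noncomputable def RealExp.eval (s : State) : RealExp → ℝ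
  | cast e => (e.eval s : ℝ)
  | get a p => s.real a (p.eval s)
  | add e f => e.eval s + f.eval s
  | sub e f => e.eval s - f.eval s
  | mul e f => e.eval s * f.eval s
  | div e f => e.eval s / f.eval s

/-- Truth of a test. -/
def Test.eval (s : State) : Test → Prop
  | intLe e f => e.eval s ≤ f.eval s
  | realLe e f => e.eval s ≤ f.eval s
  | not b => ¬ b.eval s
  | and b b' => b.eval s ∧ b'.eval s

/-- Number of elementary operations that evaluate an integer expression. -/
def IntExp.ops : IntExp → ℕ
  | const _ => 1
  | get _ p => p.ops + 1
  | add e f => e.ops + f.ops + 1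
  | sub e f => e.ops + f.ops + 1
  | mul e f => e.ops + f.ops + 1

/-- Number of elementary operations that evaluate a real expression. -/
def RealExp.ops : RealExp → ℕ
  | cast e => e.ops + 1
  | get _ p => p.ops + 1
  | add e f => e.ops + f.ops + 1
  | sub e f => e.ops + f.ops + 1
  | mul e f => e.ops + f.ops + 1
  | div e f => e.ops + f.ops + 1

/-- Number of elementary operations that evaluate a test. -/
def Test.ops : Test → ℕ
  | intLe e f => e.ops + f.ops + 1
  | realLe e f => e.ops + f.ops + 1
  | not b => b.ops + 1
  | and b b' => b.ops + b'.ops + 1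

/-- Write `v` into cell `p` of the `a`-th array of naturals. -/
def State.writeInt (s : State) (a p v : ℕ) : State :=
  { s with int := Function.update s.int a (Function.update (s.int a) p v) }

/-- Write `v` into cell `p` of the `a`-th array of reals. -/
noncomputable def State.writeReal (s : State) (a p : ℕ) (v : ℝ) : State :=
  { s with real := Function.update s.real a (Function.update (s.real a) p v) }

/-- `Exec P Q c s t N`: started in memory `s`, the program `c` halts in memory `t` after exactly
`N` elementary operations, and every natural (real) number that it stores in a cell on the way
satisfies `P` (respectively `Q`).  As expressions have constant size, bounding the bit length of
the stored numbers also bounds that of all intermediate values, up to a constant factor. -/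
inductive Exec (P : ℕ → Prop) (Q : ℝ → Prop) : Prog → State → State → ℕ → Prop
  | skip (s : State) : Exec P Q .skip s s 1
  | setInt (s : State) (a : ℕ) (p e : IntExp) (h : P (e.eval s)) :
      Exec P Q (.setInt a p e) s (s.writeInt a (p.eval s) (e.eval s)) (p.ops + e.ops + 1)
  | setReal (s : State) (a : ℕ) (p : IntExp) (e : RealExp) (h : Q (e.eval s)) :
      Exec P Q (.setReal a p e) s (s.writeReal a (p.eval s) (e.eval s)) (p.ops + e.ops + 1)
  | seq {c d : Prog} {s t r : State} {N M : ℕ} (hc : Exec P Q c s t N) (hd : Exec P Q d t r M) :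
      Exec P Q (.seq c d) s r (N + M + 1)
  | iteTrue {b : Test} {c d : Prog} {s t : State} {N : ℕ} (hb : b.eval s) (hc : Exec P Q c s t N) :
      Exec P Q (.ite b c d) s t (b.ops + N + 1)
  | iteFalse {b : Test} {c d : Prog} {s t : State} {N : ℕ} (hb : ¬ b.eval s)
      (hd : Exec P Q d s t N) : Exec P Q (.ite b c d) s t (b.ops + N + 1)
  | whileTrue {b : Test} {c : Prog} {s t r : State} {N M : ℕ} (hb : b.eval s)
      (hc : Exec P Q c s t N) (hw : Exec P Q (.while b c) t r M) :
      Exec P Q (.while b c) s r (b.ops + N + M + 1)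
  | whileFalse {b : Test} {c : Prog} {s : State} (hb : ¬ b.eval s) :
      Exec P Q (.while b c) s s (b.ops + 1)

/-- The real number `x` is rational, and its numerator and denominator in lowest terms have at
most `L` binary digits together. -/
def IsRatOfBits (L : ℕ) (x : ℝ) : Prop :=
  ∃ q : ℚ, x = (q : ℝ) ∧ q.num.natAbs.size + q.den.size ≤ L

end RAM

/-! ### Algorithms for `k`-Median -/

namespace KMedian

open RAM

/-- Memory holding the input.  Cells `0, 1, 2` of the array `0` of naturals hold
`k, |U|, |W|`; cell `i * |W| + j` of the array `1` of naturals tells whether `(i, j)` is an edge,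
and if so, the same cell of the array `0` of reals holds its cost.
All other cells are zero. -/
noncomputable def Instance.initState (I : Instance) : State where
  int a p :=
    if a = 0 then (if p = 0 then I.k else if p = 1 then I.nU else if p = 2 then I.nW else 0)
    else if a = 1 then
      (if h : p < I.nU * I.nW then
        (if finProdFinEquiv.symm ⟨p, h⟩ ∈ I.E then 1 else 0) else 0)
    else 0
  real a p :=
    if a = 0 then
      (if h : p < I.nU * I.nW then
        (if finProdFinEquiv.symm ⟨p, h⟩ ∈ I.E then
          (I.cost (finProdFinEquiv.symm ⟨p, h⟩).1 (finProdFinEquiv.symm ⟨p, h⟩).2 : ℝ) else 0)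
        else 0)
    else 0

/-- The set of centers that is output in memory `t`: array `2` of naturals holds its
characteristic vector. -/
def Instance.output (I : Instance) (t : State) : Finset (Fin I.nU) :=
  Finset.univ.filter fun i => t.int 2 (i : ℕ) = 1

/-- Given an instance satisfying `valid`, a set `C` of centers satisfying `spec` can be computed
in (strongly) polynomial time: there are one program and one polynomial `p` such that, on every
valid instance with arbitrary real costs,
* the program halts with output satisfying `spec` after at most `p (|U| + |W|)` elementary
  operations, and all naturals that it stores have at most `p (|U| + |W|)` bits;
* if moreover the costs are rational numbers of at most `L` bits each, then all reals that the
  program stores are rational numbers of at most `p (|U| + |W| + L)` bits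
  (so that the total bit cost of the computation is polynomial in the bit length of the input).
-/
def ComputableInPolyTime (valid : Instance → Prop)
    (spec : (I : Instance) → Finset (Fin I.nU) → Prop) : Prop :=
  ∃ (prog : Prog) (p : Polynomial ℕ), ∀ I : Instance, valid I →
    ∃ (t : State) (N : ℕ),
      Exec (fun v => v.size ≤ p.eval (I.nU + I.nW)) (fun _ => True) prog I.initState t N ∧
      N ≤ p.eval (I.nU + I.nW) ∧
      spec I (I.output t) ∧
      ∀ L : ℕ, (∀ i j, (i, j) ∈ I.E → IsRatOfBits L (I.cost i j : ℝ)) →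
        Exec (fun _ => True) (IsRatOfBits (p.eval (I.nU + I.nW + L))) prog I.initState t N

end KMedian

/-! The algorithm is greedy and never solves the linear program. Fix a unit cost `θ`. A center `i`
covers the pair of a customer `j` and a level `a < n^5` if `c i j ≤ a θ`, and the potential `ψ(C)`
counts the pairs that `C` leaves uncovered. Put `D = n^5 (2k+1)` and `θ = λ / ((1 - 2k/n) D)`.
Charging `1/D` per uncovered level bounds the capped cost, since all `n^5` levels of a customer
together cost exactly the cap `1/(2k+1)`. So `ψ(C) < D` suffices (`cappedCost_lt_one`).

Let `L = (1 - 2k/n) D + n`, where `n` pays for rounding costs up. If some feasible solution costs at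
most `λ > 0`, averaging over centers with weights `x u` yields a `u` with `ψ(C) - ψ(C ∪ {u}) ≥ (ψ(C)
- L)/k` (`sum_mul_decrease_ge`, `complete_of_feasible`). Adding such centers shrinks `ψ - L` by the
factor `1 - 1/k` each time, and `T` of them bring `ψ` below `D` (`lt_target_of_decay`). As greedy
only adds while `ψ ≥ D`, it uses at most `T` centers.

The optimum `λ*` is not known. But coverage depends on `θ` only through its position among the
thresholds `c i j / a`, so these and `0` are enough candidates (`exists_unitCost_complete`). Greedy
is run for each, and the result for the least successful unit cost is kept. Since `ψ` is antitone in
`θ` (`potential_anti_right`), that result also works for `λ*`. If `λ* = ∞`, every capped cost is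
`0`. All comparisons are cross-multiplied, so the program stores no real numbers and the bit bound
on reals is immediate. -/

namespace RAM

/-! ### Frame and cost rules for programs. -/

/-- The arrays of naturals that a program writes to. -/
def Prog.writes : Prog → List ℕ
  | .skip => []
  | .setInt a _ _ => [a]
  | .setReal _ _ _ => []
  | .seq c d => c.writes ++ d.writes
  | .ite _ c d => c.writes ++ d.writes
  | .while _ c => c.writes

/-- The memories `s` and `t` agree, except possibly on the arrays of naturals listed in `l`. -/
structure Agree (l : List ℕ) (s t : State) : Prop where
  real : t.real = s.real
  int : ∀ a, a ∉ l → t.int a = s.int a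

theorem Agree.refl (l : List ℕ) (s : State) : Agree l s s := ⟨rfl, fun _ _ => rfl⟩

theorem Agree.trans {l : List ℕ} {s t r : State} (h : Agree l s t) (h' : Agree l t r) :
    Agree l s r :=
  ⟨h'.real.trans h.real, fun a ha => (h'.int a ha).trans (h.int a ha)⟩

theorem Agree.mono {l l' : List ℕ} {s t : State} (h : Agree l s t) (hl : l ⊆ l') :
    Agree l' s t :=
  ⟨h.real, fun a ha => h.int a fun h' => ha (hl h')⟩

theorem State.int_writeInt (s : State) (a p v b q : ℕ) :
    (s.writeInt a p v).int b q = if b = a ∧ q = p then v else s.int b q := by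
  simp only [State.writeInt, Function.update_apply]
  by_cases hb : b = a
  · subst hb; by_cases hq : q = p <;> simp [hq]
  · simp [hb]

theorem State.int_writeInt_of_ne (s : State) {a b : ℕ} (p v : ℕ) (h : b ≠ a) :
    (s.writeInt a p v).int b = s.int b := by
  simp [State.writeInt, h]

theorem State.int_writeInt_self (s : State) (a p v : ℕ) :
    (s.writeInt a p v).int a p = v := by
  simp [State.int_writeInt]

theorem Agree.writeInt {l : List ℕ} (s : State) {a : ℕ} (p v : ℕ) (h : a ∈ l) :
    Agree l s (s.writeInt a p v) :=
  ⟨rfl, fun b hb => s.int_writeInt_of_ne p v (by rintro rfl; exact hb h)⟩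

theorem Exec.mono {P P' : ℕ → Prop} {Q Q' : ℝ → Prop} (hP : ∀ v, P v → P' v)
    (hQ : ∀ x, Q x → Q' x) {c : Prog} {s t : State} {N : ℕ} (h : Exec P Q c s t N) :
    Exec P' Q' c s t N := by
  induction h with
  | skip s => exact .skip s
  | setInt s a p e h => exact .setInt s a p e (hP _ h)
  | setReal s a p e h => exact .setReal s a p e (hQ _ h)
  | seq _ _ ihc ihd => exact .seq ihc ihd
  | iteTrue hb _ ih => exact .iteTrue hb ih
  | iteFalse hb _ ih => exact .iteFalse hb ih
  | whileTrue hb _ _ ihc ihw => exact .whileTrue hb ihc ihw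
  | whileFalse hb => exact .whileFalse hb

/-- A frame rule: with no real writes admitted, the part of the memory left alone can be read off
the syntax. The arrays are literals, so `decide` settles the side conditions later on. -/
theorem Exec.agree {P : ℕ → Prop} {c : Prog} {s t : State} {N : ℕ}
    (h : Exec P (fun _ => False) c s t N) : Agree c.writes s t := by
  induction h with
  | skip s => exact .refl _ _
  | setInt s a p e h => exact .writeInt s _ _ (by simp [Prog.writes])
  | setReal s a p e h => exact h.elim
  | seq _ _ ihc ihd =>
    exact (ihc.mono (List.subset_append_left _ _)).trans
      (ihd.mono (List.subset_append_right _ _))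
  | iteTrue hb _ ih => exact ih.mono (List.subset_append_left _ _)
  | iteFalse hb _ ih => exact ih.mono (List.subset_append_right _ _)
  | whileTrue hb _ _ ihc ihw => exact ihc.trans ihw
  | whileFalse hb => exact .refl _ _

/-- Started in memory `s`, the program `c` halts after at most `K` elementary operations in a
memory satisfying `post`; it stores no real numbers, and only natural numbers of value at most
`V`. -/
def Runs (V : ℕ) (c : Prog) (s : State) (K : ℕ) (post : State → Prop) : Prop :=
  ∃ t N, Exec (fun v => v ≤ V) (fun _ => False) c s t N ∧ N ≤ K ∧ post t

section Runs

variable {V K K₁ K₂ : ℕ} {c d : Prog} {s : State} {post mid : State → Prop}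

theorem Runs.weaken (h : Runs V c s K₁ mid) (hK : K₁ ≤ K)
    (hpost : ∀ t, Agree c.writes s t → mid t → post t) : Runs V c s K post := by
  obtain ⟨t, N, he, hN, hm⟩ := h
  exact ⟨t, N, he, hN.trans hK, hpost t he.agree hm⟩

theorem Runs.skip (hK : 1 ≤ K) (h : post s) : Runs V .skip s K post :=
  ⟨s, 1, .skip s, hK, h⟩

theorem Runs.setInt {a : ℕ} {p e : IntExp} (hV : e.eval s ≤ V)
    (hK : p.ops + e.ops + 1 ≤ K) (h : post (s.writeInt a (p.eval s) (e.eval s))) :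
    Runs V (.setInt a p e) s K post :=
  ⟨_, _, .setInt s a p e hV, hK, h⟩

theorem Runs.seq (hc : Runs V c s K₁ mid) (hK : K₁ + K₂ + 1 ≤ K)
    (hd : ∀ t, Agree c.writes s t → mid t → Runs V d t K₂ post) :
    Runs V (.seq c d) s K post := by
  obtain ⟨t, N, he, hN, hm⟩ := hc
  obtain ⟨r, M, he', hM, hp⟩ := hd t he.agree hm
  exact ⟨r, _, .seq he he', by omega, hp⟩

theorem Runs.ite {b : Test} (hK : b.ops + K₁ + 1 ≤ K)
    (hc : b.eval s → Runs V c s K₁ post) (hd : ¬ b.eval s → Runs V d s K₁ post) :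
    Runs V (.ite b c d) s K post := by
  by_cases hb : b.eval s
  · obtain ⟨t, N, he, hN, hp⟩ := hc hb
    exact ⟨t, _, .iteTrue hb he, by omega, hp⟩
  · obtain ⟨t, N, he, hN, hp⟩ := hd hb
    exact ⟨t, _, .iteFalse hb he, by omega, hp⟩

end Runs

/-- The scalar variable kept in cell `0` of the `v`-th array of naturals. -/
abbrev IntExp.var (v : ℕ) : IntExp := .get v (.const 0)

/-- `for v in [0, bound) do body`. -/
def Prog.for (v : ℕ) (bound : IntExp) (body : Prog) : Prog :=
  .seq (.setInt v (.const 0) (.const 0))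
    (.while (.not (.intLe bound (.var v)))
      (.seq body (.setInt v (.const 0) (.add (.var v) (.const 1)))))

/-- A round costs its body plus `bound.ops + 12` for test and increment; the `+ 1` in `V + 1` pays
for the initialization and the last, failing test. The bound is evaluated anew in every round, hence
`hbound`. The invariant refers to the memory after the counter is updated. -/
theorem Runs.for {V K K₁ B v : ℕ} {bound : IntExp} {body : Prog} {s₀ : State}
    (inv : ℕ → State → Prop) (hv : v ∉ body.writes) (hK : K + bound.ops + 12 ≤ K₁) (hB : B ≤ V)
    (hbound : ∀ s, Agree (v :: body.writes) s₀ s → bound.eval s = B)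
    (hinit : inv 0 (s₀.writeInt v 0 0))
    (hbody : ∀ i < B, ∀ s, Agree (v :: body.writes) s₀ s → s.int v 0 = i → inv i s →
      Runs V body s K fun t => inv (i + 1) (t.writeInt v 0 (i + 1))) :
    Runs V (.for v bound body) s₀ ((V + 1) * K₁) (inv B) := by
  have loop : ∀ m i s, i + m = B → Agree (v :: body.writes) s₀ s → s.int v 0 = i → inv i s →
      Runs V (.while (.not (.intLe bound (.var v)))
        (.seq body (.setInt v (.const 0) (.add (.var v) (.const 1))))) s
        (m * K₁ + bound.ops + 5) (inv B) := by
    intro m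
    induction m with
    | zero =>
      intro i s hi ha hs hinv
      refine ⟨s, _, .whileFalse ?_, ?_, ?_⟩
      · simp [Test.eval, IntExp.eval, hbound s ha, hs]; omega
      · simp [Test.ops, IntExp.ops]
      · simpa [← hi] using hinv
    | succ m ih =>
      intro i s hi ha hs hinv
      obtain ⟨t, N, he, hN, ht⟩ := hbody i (by omega) s ha hs hinv
      have hat := he.agree
      have htv : t.int v 0 = i := by rw [hat.int v hv, hs]
      have ha' : Agree (v :: body.writes) s₀ (t.writeInt v 0 (i + 1)) :=
        (ha.trans (hat.mono (List.subset_cons_self _ _))).trans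
          (.writeInt t _ _ (by simp))
      obtain ⟨r, M, he', hM, hr⟩ := ih (i + 1) _ (by omega) ha'
        (t.int_writeInt_self _ _ _) ht
      have hev : (IntExp.add (.var v) (.const 1)).eval t = i + 1 := by
        simp [IntExp.eval, htv]
      have hset := Exec.setInt (P := fun v => v ≤ V) (Q := fun _ => False) t v (.const 0)
        (.add (.var v) (.const 1)) (by rw [hev]; omega)
      rw [hev] at hset
      refine ⟨r, _, .whileTrue ?_ (.seq he hset) he', ?_, hr⟩
      · simp [Test.eval, IntExp.eval, hbound s ha, hs]; omega
      · simp only [Test.ops, IntExp.ops]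
        have := add_one_mul m K₁
        omega
  have h := loop B 0 (s₀.writeInt v 0 0) (by omega) (.writeInt s₀ _ _ (by simp))
    (s₀.int_writeInt_self _ _ _) hinit
  refine Runs.seq (K₁ := 3) (mid := fun t => t = s₀.writeInt v 0 0)
    (.setInt (by simp [IntExp.eval]) (by simp [IntExp.ops]) (by simp [IntExp.eval])) ?_
    (K₂ := B * K₁ + bound.ops + 5) ?_
  · have := Nat.mul_le_mul_right K₁ hB
    have := add_one_mul V K₁
    omega
  · rintro t - rfl
    exact h

end RAM

/-! ### The greedy algorithm and its potential. -/

namespace KMedian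

variable (I : Instance)

/-- The number of levels to which assignment costs are rounded. -/
def levels : ℕ := I.nW ^ 5

/-- The bound on the potential that is to be reached. -/
def target : ℕ := levels I * (2 * I.k + 1)

/-- Center `i` serves customer `j` at level `a`, for the unit cost `θ`. -/
def Covers (θ : ℝ) (i : Fin I.nU) (j : Fin I.nW) (a : ℕ) : Prop :=
  (i, j) ∈ I.E ∧ (I.cost i j : ℝ) ≤ a * θ

open Classical in
/-- The levels at which no center of `C` serves customer `j`. -/
noncomputable def uncovered (θ : ℝ) (C : Finset (Fin I.nU)) (j : Fin I.nW) : Finset ℕ :=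
  (Finset.range (levels I)).filter fun a => ∀ i ∈ C, ¬ Covers I θ i j a

/-- The number of pairs of a customer and a level that are not covered by `C`. -/
noncomputable def potential (θ : ℝ) (C : Finset (Fin I.nU)) : ℕ :=
  ∑ j, (uncovered I θ C j).card

/-- Adding `u` to `C` reduces the potential as much as the linear program promises. -/
def Progress (θ : ℝ) (C : Finset (Fin I.nU)) (u : Fin I.nU) : Prop :=
  I.nW * I.k * potential I θ (insert u C) + I.nW * potential I θ C + 2 * I.k * target I ≤
    I.nW * I.k * potential I θ C + I.nW * target I + I.nW * I.nW

/-- As long as the target is not reached, some center makes progress. -/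
def Complete (θ : ℝ) : Prop :=
  ∀ C, target I ≤ potential I θ C → ∃ u, Progress I θ C u

open Classical in
/-- Add center `u` if the target is not yet reached and `u` makes progress. -/
noncomputable def greedyStep (θ : ℝ) (C : Finset (Fin I.nU)) (u : Fin I.nU) :
    Finset (Fin I.nU) :=
  if target I ≤ potential I θ C ∧ Progress I θ C u then insert u C else C

/-- Try the first `m` centers, one after the other. -/
noncomputable def sweep (θ : ℝ) (C : Finset (Fin I.nU)) : ℕ → Finset (Fin I.nU)
  | 0 => C
  | m + 1 => if h : m < I.nU then greedyStep I θ (sweep θ C m) ⟨m, h⟩ else sweep θ C m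

/-- The set of centers after `r` sweeps over all the centers. -/
noncomputable def greedy (θ : ℝ) : ℕ → Finset (Fin I.nU)
  | 0 => ∅
  | r + 1 => sweep I θ (greedy θ r) I.nU

/-- The set of centers that the greedy algorithm ends with. -/
noncomputable def greedySet (θ : ℝ) : Finset (Fin I.nU) :=
  greedy I θ (I.nW * levels I)

variable {I}

theorem potential_le (θ : ℝ) (C : Finset (Fin I.nU)) :
    potential I θ C ≤ I.nW * levels I := by
  classical
  calc potential I θ C ≤ ∑ _j : Fin I.nW, levels I :=
        Finset.sum_le_sum fun j _ => (Finset.card_filter_le _ _).trans (by simp)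
    _ = I.nW * levels I := by simp

/-- A larger unit cost lets every center cover more. This carries a set found at a small unit cost
over to the unit cost of the optimum. -/
theorem potential_anti_right {θ θ' : ℝ} (h : θ ≤ θ') (C : Finset (Fin I.nU)) :
    potential I θ' C ≤ potential I θ C := by
  classical
  refine Finset.sum_le_sum fun j _ => Finset.card_le_card ?_
  refine Finset.monotone_filter_right _ fun a _ ha i hi hc => ha i hi ⟨hc.1, hc.2.trans ?_⟩
  gcongr

theorem potential_congr {θ θ' : ℝ}
    (h : ∀ i j, ∀ a < levels I, Covers I θ i j a ↔ Covers I θ' i j a) (C : Finset (Fin I.nU)) :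
    potential I θ C = potential I θ' C := by
  classical
  refine Finset.sum_congr rfl fun j _ => congrArg Finset.card ?_
  refine Finset.filter_congr fun a ha => forall₂_congr fun i _ => not_congr ?_
  exact h i j a (Finset.mem_range.mp ha)

theorem Complete.congr {θ θ' : ℝ}
    (h : ∀ i j, ∀ a < levels I, Covers I θ i j a ↔ Covers I θ' i j a) (hθ : Complete I θ) :
    Complete I θ' := by
  intro C hC
  obtain ⟨u, hu⟩ := hθ C (by rwa [potential_congr h])
  exact ⟨u, by simpa only [Progress, potential_congr h] using hu⟩

section Parameters

variable (hk : 2 ≤ I.k) (hn : 3 * I.k ≤ I.nW)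
include hk hn

theorem levels_pos : 0 < levels I := pow_pos (by omega) _

theorem target_pos : 0 < target I := Nat.mul_pos (levels_pos hk hn) (by omega)

theorem sq_lt_mul_target : I.nW * I.nW < 2 * I.k * target I := by
  have h1 : I.nW ^ 2 ≤ levels I := Nat.pow_le_pow_right (by omega) (by omega)
  have h2 : 0 < levels I := levels_pos hk hn
  have h3 : levels I * 1 ≤ target I := Nat.mul_le_mul_left _ (by omega)
  have h4 : 4 * target I ≤ 2 * I.k * target I := Nat.mul_le_mul_right _ (by omega)
  nlinarith

/-- Above the target `D`, the promised decrease times `n k` is at least `n (ψ - D) + 2kD - n²`, and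
`n² < 2kD` because there are so many levels. -/
theorem Progress.potential_lt {θ : ℝ} {C : Finset (Fin I.nU)} {u : Fin I.nU}
    (h : Progress I θ C u) (hC : target I ≤ potential I θ C) :
    potential I θ (insert u C) < potential I θ C := by
  have h1 := sq_lt_mul_target hk hn
  have h2 : I.nW * target I ≤ I.nW * potential I θ C := Nat.mul_le_mul_left _ hC
  unfold Progress at h
  have h3 : I.nW * I.k * potential I θ (insert u C) < I.nW * I.k * potential I θ C := by omega
  exact lt_of_mul_lt_mul_left h3 (Nat.zero_le _)

theorem potential_greedyStep_le (θ : ℝ) (C : Finset (Fin I.nU)) (u : Fin I.nU) :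
    potential I θ (greedyStep I θ C u) ≤ potential I θ C := by
  unfold greedyStep
  split_ifs with h
  · exact (h.2.potential_lt hk hn h.1).le
  · exact le_rfl

theorem potential_sweep_le (θ : ℝ) (C : Finset (Fin I.nU)) (m : ℕ) :
    potential I θ (sweep I θ C m) ≤ potential I θ C := by
  induction m with
  | zero => exact le_rfl
  | succ m ih =>
    rw [sweep]
    split_ifs with h
    · exact (potential_greedyStep_le hk hn θ _ _).trans ih
    · exact ih

/-- Until something is added, every center is tested against the original `C`; the first success
lowers the potential for good. -/
theorem potential_sweep_lt_or (θ : ℝ) (C : Finset (Fin I.nU)) (hC : target I ≤ potential I θ C)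
    (m : ℕ) : potential I θ (sweep I θ C m) < potential I θ C ∨
      (sweep I θ C m = C ∧ ∀ u : Fin I.nU, (u : ℕ) < m → ¬ Progress I θ C u) := by
  induction m with
  | zero => exact .inr ⟨rfl, fun u hu => absurd hu (Nat.not_lt_zero _)⟩
  | succ m ih =>
    rw [sweep]
    rcases ih with ih | ⟨ih, ih'⟩
    · left
      split_ifs with h
      · exact (potential_greedyStep_le hk hn θ _ _).trans_lt ih
      · exact ih
    · rw [ih]
      split_ifs with h
      · by_cases hp : Progress I θ C ⟨m, h⟩
        · left
          rw [greedyStep, if_pos ⟨hC, hp⟩]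
          exact hp.potential_lt hk hn hC
        · right
          refine ⟨by rw [greedyStep, if_neg fun h' => hp h'.2], fun u hu => ?_⟩
          rcases Nat.lt_succ_iff_lt_or_eq.mp hu with hu | hu
          · exact ih' u hu
          · have : u = ⟨m, h⟩ := Fin.ext hu
            rwa [this]
      · exact .inr ⟨rfl, fun u hu => ih' u (by have := u.2; omega)⟩

/-- Completeness rules out an idle sweep above the target, so each such sweep covers at least one
more of the at most `n * levels` uncovered pairs. -/
theorem Complete.potential_greedySet_lt {θ : ℝ} (hθ : Complete I θ) :
    potential I θ (greedySet I θ) < target I := by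
  have key : ∀ r, potential I θ (greedy I θ r) < target I ∨
      potential I θ (greedy I θ r) + r ≤ I.nW * levels I := by
    intro r
    induction r with
    | zero => exact .inr (potential_le _ _)
    | succ r ih =>
      by_cases hlt : potential I θ (greedy I θ r) < target I
      · exact .inl ((potential_sweep_le hk hn θ _ _).trans_lt hlt)
      · have hle := not_lt.mp hlt
        rcases potential_sweep_lt_or hk hn θ _ hle I.nU with h | ⟨-, h⟩
        · right
          have := ih.resolve_left hlt
          rw [greedy]; omega
        · obtain ⟨u, hu⟩ := hθ _ hle
          exact absurd hu (h u u.2)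
  have := target_pos hk hn
  rcases key (I.nW * levels I) with h | h
  · exact h
  · unfold greedySet; omega

end Parameters

/-! ### The bound `T` on the number of centers. -/

variable (I) in
/-- The fixed point of the recurrence for the potential. -/
noncomputable def limitPotential : ℝ :=
  (1 - 2 * (I.k : ℝ) / I.nW) * target I + I.nW

section Budget

variable (hk : 2 ≤ I.k) (hn : 3 * I.k ≤ I.nW)
include hk hn

/-- With `q = (1 - 1/k)^T` and `X = n² / (2k(2k+1))`, the choice of `T` gives `q ≤ 1/X`, and `n *
n^5 = X (2k/n) D`, so `q n^6 ≤ (2k/n) D`. Hence `ψ ≤ D + n - q L`. The rounding error `n` is beaten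
by `q L`: `L` has order at least `n^5`, while `q n^4` stays large. -/
theorem lt_target_of_decay {ψ : ℝ} (h : ψ - limitPotential I ≤
    (1 - 1 / (I.k : ℝ)) ^ firstPhaseSize I * (I.nW * levels I - limitPotential I)) :
    ψ < target I := by
  have hk' : (2 : ℝ) ≤ I.k := by exact_mod_cast hk
  have hn' : 3 * (I.k : ℝ) ≤ I.nW := by exact_mod_cast hn
  have hD : (target I : ℝ) = (I.nW : ℝ) ^ 5 * (2 * I.k + 1) := by
    simp [target, levels]
  have hA : (levels I : ℝ) = (I.nW : ℝ) ^ 5 := by simp [levels]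
  unfold limitPotential firstPhaseSize at h
  rw [hD] at h ⊢
  rw [hA] at h
  generalize (I.k : ℝ) = k at *
  generalize (I.nW : ℝ) = n at *
  have hn0 : 0 < n := by linarith
  have hk0 : 0 < k := by linarith
  set X : ℝ := n ^ 2 / (2 * k * (2 * k + 1)) with hX
  have hX0 : 0 < X := by positivity
  set T : ℕ := ⌈k * Real.log X⌉₊ with hT
  set q : ℝ := (1 - 1 / k) ^ T with hq
  have hX1 : 1 ≤ X := by
    rw [hX, le_div_iff₀ (by positivity)]; nlinarith
  have hX2 : X ≤ n ^ 2 / 20 := by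
    rw [hX]
    gcongr
    nlinarith
  have hk1 : 1 / k ≤ 1 / 2 := one_div_le_one_div_of_le (by norm_num) hk'
  have hlog : 0 ≤ Real.log X := Real.log_nonneg hX1
  have hqX : q * X ≤ 1 := by
    have h1 : q ≤ Real.exp (-(1 / k)) ^ T := by
      refine pow_le_pow_left₀ (by linarith) ?_ _
      have := Real.add_one_le_exp (-(1 / k)); linarith
    have h2 : Real.exp (-(1 / k)) ^ T ≤ X⁻¹ := by
      rw [← Real.exp_nat_mul, ← Real.exp_log (inv_pos.mpr hX0), Real.log_inv]
      refine Real.exp_le_exp.mpr ?_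
      have := Nat.le_ceil (k * Real.log X)
      have h3 : Real.log X ≤ (T : ℝ) * (1 / k) := by
        rw [mul_one_div, le_div_iff₀ hk0]; linarith
      linarith
    calc q * X ≤ X⁻¹ * X := by gcongr; exact h1.trans h2
      _ = 1 := inv_mul_cancel₀ hX0.ne'
  -- From `1 - 1/k ≥ exp (-2/k)` and a ceiling that adds at most one step, `q ≥ X⁻² / 4`, where `1/4
  -- < exp (-1)`. Then `X ≤ n²/20` gives `400/4`.
  have hqlow : 100 ≤ q * n ^ 4 := by
    have h1 : Real.exp (-(2 / k)) ≤ 1 - 1 / k := by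
      have h3 : 0 < 1 - 1 / k := by linarith
      have h4 := Real.add_one_le_exp (2 / k)
      have h5 : 1 ≤ (1 - 1 / k) * (2 / k + 1) := by
        have : 2 / k = 2 * (1 / k) := by ring
        rw [this]
        have : 0 < 1 / k := by positivity
        nlinarith
      rw [Real.exp_neg, inv_le_iff_one_le_mul₀ (Real.exp_pos _)]
      nlinarith
    have h2 : Real.exp (-(2 / k)) ^ T ≤ q :=
      pow_le_pow_left₀ (Real.exp_pos _).le h1 _
    have h3 : (X ^ 2)⁻¹ * (1 / 4) ≤ Real.exp (-(2 / k)) ^ T := by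
      have h4 : (T : ℝ) ≤ k * Real.log X + 1 := (Nat.ceil_lt_add_one (by positivity)).le
      have h5 : -(2 * Real.log X) + (-1) ≤ (T : ℝ) * -(2 / k) := by
        have h6 : (T : ℝ) * (2 / k) ≤ (k * Real.log X + 1) * (2 / k) := by gcongr
        have h7 : (k * Real.log X + 1) * (2 / k) = 2 * Real.log X + 2 * (1 / k) := by
          field_simp
        linarith
      rw [← Real.exp_nat_mul]
      refine le_trans ?_ (Real.exp_le_exp.mpr h5)
      rw [Real.exp_add]
      have h8 : Real.exp (-(2 * Real.log X)) = (X ^ 2)⁻¹ := by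
        rw [Real.exp_neg, two_mul, Real.exp_add, Real.exp_log hX0, sq]
      rw [h8]
      gcongr
      rw [Real.exp_neg, one_div]
      have := Real.exp_one_lt_d9
      gcongr
      linarith
    have h4 : 400 ≤ (X ^ 2)⁻¹ * n ^ 4 := by
      rw [inv_mul_eq_div, le_div_iff₀ (by positivity)]
      nlinarith
    have h5 : (X ^ 2)⁻¹ * (1 / 4) * n ^ 4 ≤ q * n ^ 4 := by
      gcongr; exact h3.trans h2
    linarith
  have hq0 : 0 ≤ q := pow_nonneg (by linarith) _
  have hα : 1 / 3 ≤ 1 - 2 * k / n := by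
    have : 2 * k / n ≤ 2 / 3 := by rw [div_le_div_iff₀ hn0 (by norm_num)]; linarith
    linarith
  have hup : q * (n * n ^ 5) ≤ 2 * k / n * (n ^ 5 * (2 * k + 1)) := by
    have h1 : n * n ^ 5 = X * (2 * k / n * (n ^ 5 * (2 * k + 1))) := by
      rw [hX]; field_simp
    rw [h1, ← mul_assoc]
    have h2 : 0 ≤ 2 * k / n * (n ^ 5 * (2 * k + 1)) := by positivity
    nlinarith
  have hlow : n < q * ((1 - 2 * k / n) * (n ^ 5 * (2 * k + 1)) + n) := by
    -- The constant is the product of `1 - 2k/n ≥ 1/3` and `2k + 1 ≥ 5`.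
    have h1 : 5 / 3 * n ^ 5 ≤ (1 - 2 * k / n) * (n ^ 5 * (2 * k + 1)) := by
      have : 5 / 3 * n ^ 5 = 1 / 3 * (n ^ 5 * 5) := by ring
      rw [this]
      gcongr
      linarith
    calc n < q * n ^ 4 * (5 / 3 * n) := by nlinarith
      _ = q * (5 / 3 * n ^ 5 + 0) := by ring
      _ ≤ _ := by gcongr
  linarith

omit hk hn in
/-- The invariant of the greedy algorithm that bounds the number of centers. -/
def WithinBudget (I : Instance) (θ : ℝ) (C : Finset (Fin I.nU)) : Prop :=
  ∃ s, C.card ≤ s ∧ s ≤ firstPhaseSize I ∧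
    potential I θ C - limitPotential I ≤
      (1 - 1 / (I.k : ℝ)) ^ s * (I.nW * levels I - limitPotential I)

omit hk hn in
theorem withinBudget_empty (θ : ℝ) : WithinBudget I θ ∅ := by
  refine ⟨0, by simp, Nat.zero_le _, ?_⟩
  have : (potential I θ ∅ : ℝ) ≤ I.nW * levels I := by exact_mod_cast potential_le θ ∅
  linarith

/-- After `T` counted steps the decay puts the potential below the target, where nothing is added
any more. So an actual addition has `s < T` and leaves room for `s + 1`. Completeness plays no role:
a center is added only if it makes progress. -/
theorem WithinBudget.greedyStep {θ : ℝ} {C : Finset (Fin I.nU)} (h : WithinBudget I θ C)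
    (u : Fin I.nU) : WithinBudget I θ (greedyStep I θ C u) := by
  unfold KMedian.greedyStep
  split_ifs with hu
  swap
  · exact h
  obtain ⟨hC, hu⟩ := hu
  obtain ⟨s, hs, hsT, hdec⟩ := h
  have hsT' : s < firstPhaseSize I := by
    refine lt_of_le_of_ne hsT fun he => ?_
    rw [he] at hdec
    have := lt_target_of_decay hk hn hdec
    exact absurd hC (not_le.mpr (by exact_mod_cast this))
  refine ⟨s + 1, (Finset.card_insert_le _ _).trans (by omega), hsT', ?_⟩
  have hk' : (2 : ℝ) ≤ I.k := by exact_mod_cast hk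
  have hn' : 3 * (I.k : ℝ) ≤ I.nW := by exact_mod_cast hn
  have hn0 : (0 : ℝ) < I.nW := by linarith
  have hk0 : (0 : ℝ) < I.k := by linarith
  have hu' : (I.nW : ℝ) * I.k * potential I θ (insert u C) + I.nW * potential I θ C +
      2 * I.k * target I ≤ I.nW * I.k * potential I θ C + I.nW * target I + I.nW * I.nW := by
    exact_mod_cast hu
  have hstep : (potential I θ (insert u C) : ℝ) - limitPotential I ≤
      (1 - 1 / (I.k : ℝ)) * (potential I θ C - limitPotential I) := by
    have h1 : 0 < (I.nW : ℝ) * I.k := by positivity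
    refine le_of_mul_le_mul_left ?_ h1
    unfold limitPotential
    have h2 : (I.nW : ℝ) * I.k * ((1 - 1 / (I.k : ℝ)) * (potential I θ C -
        ((1 - 2 * (I.k : ℝ) / I.nW) * target I + I.nW))) =
        (I.k - 1) * (I.nW * potential I θ C - ((I.nW - 2 * I.k) * target I + I.nW * I.nW)) := by
      field_simp
    have h3 : (I.nW : ℝ) * I.k * (potential I θ (insert u C) -
        ((1 - 2 * (I.k : ℝ) / I.nW) * target I + I.nW)) =
        I.nW * I.k * potential I θ (insert u C) -
          I.k * ((I.nW - 2 * I.k) * target I + I.nW * I.nW) := by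
      field_simp
    rw [h2, h3]
    linarith
  have hk1 : 1 / (I.k : ℝ) ≤ 1 / 2 := one_div_le_one_div_of_le (by norm_num) hk'
  calc (potential I θ (insert u C) : ℝ) - limitPotential I
      ≤ (1 - 1 / (I.k : ℝ)) * (potential I θ C - limitPotential I) := hstep
    _ ≤ (1 - 1 / (I.k : ℝ)) * ((1 - 1 / (I.k : ℝ)) ^ s *
          (I.nW * levels I - limitPotential I)) := by
        gcongr
        linarith
    _ = _ := by ring

theorem withinBudget_sweep {θ : ℝ} {C : Finset (Fin I.nU)} (h : WithinBudget I θ C) (m : ℕ) :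
    WithinBudget I θ (sweep I θ C m) := by
  induction m with
  | zero => exact h
  | succ m ih =>
    rw [sweep]
    split_ifs with hm
    · exact ih.greedyStep hk hn _
    · exact ih

theorem card_greedySet_le (θ : ℝ) : (greedySet I θ).card ≤ firstPhaseSize I := by
  have key : ∀ r, WithinBudget I θ (greedy I θ r) := by
    intro r
    induction r with
    | zero => exact withinBudget_empty θ
    | succ r ih => exact withinBudget_sweep hk hn ih _
  obtain ⟨s, hs, hsT, -⟩ := key (I.nW * levels I)
  exact hs.trans hsT

end Budget

end KMedian

/-! ### Averaging over a fractional solution. -/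

namespace KMedian

variable {I : Instance}

theorem uncovered_insert (θ : ℝ) (C : Finset (Fin I.nU)) (u : Fin I.nU) (j : Fin I.nW) :
    uncovered I θ (insert u C) j = uncovered I θ C j ∩ uncovered I θ {u} j := by
  classical
  ext a
  simp only [uncovered, Finset.mem_filter, Finset.mem_inter, Finset.mem_insert,
    Finset.mem_singleton, forall_eq_or_imp, forall_eq]
  tauto

/-- Any positive weight on a non-edge contributes `∞ * y = ∞`, so finite cost confines `y` to the
edges. -/
theorem lpCost_eq_ofReal {x : Fin I.nU → ℝ} {y : Fin I.nU → Fin I.nW → ℝ}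
    (h : LPFeasible I x y) (hfin : lpCost I y ≠ ⊤) :
    (∀ i j, (i, j) ∉ I.E → y i j = 0) ∧
      lpCost I y = ENNReal.ofReal (∑ i, ∑ j, (I.cost i j : ℝ) * y i j) := by
  have hE : ∀ i j, (i, j) ∉ I.E → y i j = 0 := by
    intro i j hij
    by_contra hy
    refine hfin ?_
    unfold lpCost
    rw [ENNReal.sum_eq_top]
    refine ⟨i, Finset.mem_univ _, ?_⟩
    rw [ENNReal.sum_eq_top]
    refine ⟨j, Finset.mem_univ _, ?_⟩
    rw [Instance.c, if_neg hij, ENNReal.top_mul]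
    have := lt_of_le_of_ne (h.nonneg i j) (Ne.symm hy)
    simpa using this
  refine ⟨hE, ?_⟩
  have hnn : ∀ i j, 0 ≤ (I.cost i j : ℝ) * y i j := fun i j =>
    mul_nonneg (NNReal.coe_nonneg _) (h.nonneg i j)
  unfold lpCost
  rw [ENNReal.ofReal_sum_of_nonneg fun i _ => Finset.sum_nonneg fun j _ => hnn i j]
  refine Finset.sum_congr rfl fun i _ => ?_
  rw [ENNReal.ofReal_sum_of_nonneg fun j _ => hnn i j]
  refine Finset.sum_congr rfl fun j _ => ?_
  by_cases hij : (i, j) ∈ I.E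
  · rw [Instance.c, if_pos hij, ENNReal.ofReal_mul (NNReal.coe_nonneg _),
      ENNReal.ofReal_coe_nnreal]
  · simp [hE i j hij]

/-- A center on an edge fails to serve its customer at about `c i j / θ` levels. -/
theorem card_uncovered_singleton_le {θ : ℝ} (hθ : 0 < θ) {i : Fin I.nU} {j : Fin I.nW}
    (hij : (i, j) ∈ I.E) :
    ((uncovered I θ {i} j).card : ℝ) ≤ I.cost i j / θ + 1 := by
  classical
  have hsub : uncovered I θ {i} j ⊆ Finset.range ⌈(I.cost i j : ℝ) / θ⌉₊ := by
    intro a ha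
    simp only [uncovered, Finset.mem_filter, Finset.mem_singleton, forall_eq, Covers,
      hij, true_and, not_le] at ha
    rw [Finset.mem_range, Nat.lt_ceil, lt_div_iff₀ hθ]
    exact ha.2
  have h1 := Finset.card_le_card hsub
  rw [Finset.card_range] at h1
  have h2 : 0 ≤ (I.cost i j : ℝ) / θ := by positivity
  calc ((uncovered I θ {i} j).card : ℝ) ≤ ⌈(I.cost i j : ℝ) / θ⌉₊ := by exact_mod_cast h1
    _ ≤ _ := (Nat.ceil_lt_add_one h2).le

/-- For each customer the decrease is nonnegative, so its weight `x u` may be lowered to `y u j`.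
After adding `u`, at most `c u j / θ + 1` levels remain uncovered. The weights `y u j` sum to one
over `u`. -/
theorem sum_mul_decrease_ge {x : Fin I.nU → ℝ} {y : Fin I.nU → Fin I.nW → ℝ}
    (h : LPFeasible I x y) (hfin : lpCost I y ≠ ⊤) {θ : ℝ} (hθ : 0 < θ)
    (C : Finset (Fin I.nU)) :
    (potential I θ C : ℝ) - ((∑ i, ∑ j, (I.cost i j : ℝ) * y i j) / θ + I.nW) ≤
      ∑ u, x u * (potential I θ C - potential I θ (insert u C)) := by
  classical
  have hE := (lpCost_eq_ofReal h hfin).1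
  have h1 : ∀ u j, y u j * ((uncovered I θ C j).card - (I.cost u j / θ + 1)) ≤
      x u * ((uncovered I θ C j).card - (uncovered I θ (insert u C) j).card : ℝ) := by
    intro u j
    have hle : ((uncovered I θ (insert u C) j).card : ℝ) ≤ (uncovered I θ C j).card := by
      rw [uncovered_insert]
      exact_mod_cast Finset.card_le_card Finset.inter_subset_left
    refine le_trans ?_ (mul_le_mul_of_nonneg_right (h.le u j) (sub_nonneg.mpr hle))
    by_cases hij : (u, j) ∈ I.E
    · refine mul_le_mul_of_nonneg_left ?_ (h.nonneg u j)
      have h2 := card_uncovered_singleton_le hθ hij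
      have h3 : ((uncovered I θ (insert u C) j).card : ℝ) ≤ (uncovered I θ {u} j).card := by
        rw [uncovered_insert]
        exact_mod_cast Finset.card_le_card Finset.inter_subset_right
      linarith
    · simp [hE u j hij]
  calc (potential I θ C : ℝ) - ((∑ i, ∑ j, (I.cost i j : ℝ) * y i j) / θ + I.nW)
      = ∑ u, ∑ j, y u j * ((uncovered I θ C j).card - (I.cost u j / θ + 1)) := by
        have e1 : ∀ u j, y u j * (((uncovered I θ C j).card : ℝ) - (I.cost u j / θ + 1)) =
            y u j * ((uncovered I θ C j).card - 1) - (I.cost u j : ℝ) * y u j / θ := by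
          intro u j; ring
        simp only [e1, Finset.sum_sub_distrib, ← Finset.sum_div]
        rw [Finset.sum_comm (f := fun u j => y u j * (((uncovered I θ C j).card : ℝ) - 1))]
        simp only [← Finset.sum_mul, h.assign, one_mul, Finset.sum_sub_distrib, potential,
          Nat.cast_sum]
        simp
        ring
    _ ≤ ∑ u, ∑ j, x u * ((uncovered I θ C j).card - (uncovered I θ (insert u C) j).card : ℝ) :=
        Finset.sum_le_sum fun u _ => Finset.sum_le_sum fun j _ => h1 u j
    _ = _ := by
        simp only [← Finset.mul_sum, Finset.sum_sub_distrib, potential, Nat.cast_sum]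

/-! ### Unit costs: the one for the optimum, and the finitely many candidates. -/

variable (I) in
/-- The unit cost for which rounding costs up loses nothing against the cap, when the optimum
cost is `lam`. -/
noncomputable def unitCostOf (lam : ℝ) : ℝ :=
  lam / ((1 - 2 * (I.k : ℝ) / I.nW) * target I)

variable (I) in
/-- The candidates for the unit cost, `0` and the fractions of the costs. -/
noncomputable def unitCost (e b : ℕ) : ℝ :=
  I.initState.real 0 e / (b + 1)

theorem initState_real (i : Fin I.nU) (j : Fin I.nW) :
    I.initState.real 0 (i * I.nW + j) = if (i, j) ∈ I.E then (I.cost i j : ℝ) else 0 := by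
  have h : (i * I.nW + j : ℕ) = finProdFinEquiv (i, j) := by
    simp [finProdFinEquiv_apply_val]; ring
  simp only [Instance.initState, if_true, h, Fin.is_lt, dite_true, Fin.eta,
    Equiv.symm_apply_apply]

theorem initState_int_one (i : Fin I.nU) (j : Fin I.nW) :
    I.initState.int 1 (i * I.nW + j) = if (i, j) ∈ I.E then 1 else 0 := by
  have h : (i * I.nW + j : ℕ) = finProdFinEquiv (i, j) := by
    simp [finProdFinEquiv_apply_val]; ring
  simp only [Instance.initState, one_ne_zero, if_false, if_true, h, Fin.is_lt, dite_true, Fin.eta,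
    Equiv.symm_apply_apply]

section Parameters

variable (hk : 2 ≤ I.k) (hn : 3 * I.k ≤ I.nW)
include hk hn

theorem one_sub_pos : 0 < 1 - 2 * (I.k : ℝ) / I.nW := by
  have hk' : (2 : ℝ) ≤ I.k := by exact_mod_cast hk
  have hn' : 3 * (I.k : ℝ) ≤ I.nW := by exact_mod_cast hn
  rw [sub_pos, div_lt_one (by linarith)]
  linarith

theorem one_sub_mul_target_pos : 0 < (1 - 2 * (I.k : ℝ) / I.nW) * target I :=
  mul_pos (one_sub_pos hk hn) (by exact_mod_cast target_pos hk hn)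

/-- If every center fell short of the promised decrease, so would their average with weights `x u /
k`, against `sum_mul_decrease_ge`. -/
theorem complete_of_feasible {x : Fin I.nU → ℝ} {y : Fin I.nU → Fin I.nW → ℝ}
    (h : LPFeasible I x y) {v : ℝ} (hv : 0 < v) (hcost : lpCost I y ≤ ENNReal.ofReal v) :
    Complete I (unitCostOf I v) := by
  intro C hC
  have hpos := one_sub_mul_target_pos hk hn
  have hθ : 0 < unitCostOf I v := div_pos hv hpos
  have hfin : lpCost I y ≠ ⊤ := ne_top_of_le_ne_top ENNReal.ofReal_ne_top hcost
  have hsum := sum_mul_decrease_ge h hfin hθ C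
  have hv' : ∑ i, ∑ j, (I.cost i j : ℝ) * y i j ≤ v := by
    rw [(lpCost_eq_ofReal h hfin).2] at hcost
    exact (ENNReal.ofReal_le_ofReal_iff hv.le).mp hcost
  have hdiv : (∑ i, ∑ j, (I.cost i j : ℝ) * y i j) / unitCostOf I v ≤
      (1 - 2 * (I.k : ℝ) / I.nW) * target I := by
    rw [div_le_iff₀ hθ, unitCostOf, mul_div_cancel₀ _ hpos.ne']
    exact hv'
  have hn0 : (0 : ℝ) < I.nW := by exact_mod_cast (by omega : 0 < I.nW)
  have hk0 : (0 : ℝ) < I.k := by exact_mod_cast (by omega : 0 < I.k)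
  -- Nonnegativity of `x` follows from `0 ≤ y ≤ x` at any one customer.
  have hx : ∀ u, 0 ≤ x u := fun u =>
    (h.nonneg u ⟨0, by omega⟩).trans (h.le u ⟨0, by omega⟩)
  by_contra! hno
  have hlt : ∀ u, (I.k : ℝ) * (potential I (unitCostOf I v) C -
      potential I (unitCostOf I v) (insert u C)) <
      potential I (unitCostOf I v) C - limitPotential I := by
    intro u
    have h1 := hno u
    unfold Progress at h1
    rw [not_le] at h1
    have h2 : (I.nW : ℝ) * I.k * potential I (unitCostOf I v) C + I.nW * target I +
        I.nW * I.nW < I.nW * I.k * potential I (unitCostOf I v) (insert u C) +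
          I.nW * potential I (unitCostOf I v) C + 2 * I.k * target I := by
      exact_mod_cast h1
    refine lt_of_mul_lt_mul_left ?_ hn0.le
    have h3 : (I.nW : ℝ) * (potential I (unitCostOf I v) C - limitPotential I) =
        I.nW * potential I (unitCostOf I v) C - ((I.nW - 2 * I.k) * target I + I.nW * I.nW) := by
      unfold limitPotential
      field_simp
    rw [h3]
    linarith
  -- A nonzero weight keeps the averaged inequality strict.
  have hex : ∃ u ∈ Finset.univ, x u ≠ 0 :=
    Finset.exists_ne_zero_of_sum_ne_zero (by rw [h.size]; exact hk0.ne')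
  obtain ⟨u₀, -, hu₀⟩ := hex
  have hstrict : ∑ u, x u * ((I.k : ℝ) * (potential I (unitCostOf I v) C -
      potential I (unitCostOf I v) (insert u C))) <
      ∑ u, x u * (potential I (unitCostOf I v) C - limitPotential I) :=
    Finset.sum_lt_sum (fun u _ => mul_le_mul_of_nonneg_left (hlt u).le (hx u))
      ⟨u₀, Finset.mem_univ _, mul_lt_mul_of_pos_left (hlt u₀)
        (lt_of_le_of_ne (hx u₀) (Ne.symm hu₀))⟩
  rw [← Finset.sum_mul, h.size] at hstrict
  have hcomm : ∑ u, x u * ((I.k : ℝ) * (potential I (unitCostOf I v) C -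
      potential I (unitCostOf I v) (insert u C))) =
      I.k * ∑ u, x u * ((potential I (unitCostOf I v) C : ℝ) -
        potential I (unitCostOf I v) (insert u C)) := by
    rw [Finset.mul_sum]
    exact Finset.sum_congr rfl fun u _ => by ring
  rw [hcomm] at hstrict
  have h4 := lt_of_mul_lt_mul_left hstrict hk0.le
  unfold limitPotential at h4
  linarith

/-- The proof avoids attainment of the infimum and the degenerate case `λ* = 0` by using a slightly
larger `θ₁` with no candidate in `(θ, θ₁]`. Lowering `θ₁` to the largest candidate `θ₂` below it
crosses no threshold `c i j / a`, so coverage and completeness survive, and `θ₂ ≤ θ`. -/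
theorem exists_unitCost_complete (hfin : lpOpt I ≠ ⊤) :
    ∃ e ≤ I.nU * I.nW, ∃ b < levels I,
      unitCost I e b ≤ unitCostOf I (lpOpt I).toReal ∧ Complete I (unitCost I e b) := by
  classical
  have hpos := one_sub_mul_target_pos hk hn
  set θ := unitCostOf I (lpOpt I).toReal with hθ
  have hθ0 : 0 ≤ θ := div_nonneg ENNReal.toReal_nonneg hpos.le
  set S : Finset ℝ := (Finset.range (I.nU * I.nW + 1) ×ˢ Finset.range (levels I)).image
    fun p => unitCost I p.1 p.2 with hS
  have hmem : ∀ e ≤ I.nU * I.nW, ∀ b < levels I, unitCost I e b ∈ S := fun e he b hb =>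
    Finset.mem_image.mpr ⟨(e, b), by simp; omega, rfl⟩
  obtain ⟨θ₁, hS₁, hθ₁⟩ : ∃ θ₁, (∀ s ∈ S, s ≤ θ₁ → s ≤ θ) ∧ θ < θ₁ := by
    have hev : ∀ᶠ z in nhdsWithin θ (Set.Ioi θ), ∀ s ∈ S, s ≤ z → s ≤ θ := by
      rw [Filter.eventually_all_finset]
      intro s _
      by_cases hs : s ≤ θ
      · exact Filter.Eventually.of_forall fun _ _ => hs
      · filter_upwards [Ioo_mem_nhdsGT (not_le.mp hs)] with z hz hsz
        exact absurd hz.2 (not_lt.mpr hsz)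
    exact (hev.and self_mem_nhdsWithin).exists
  have hcomplete : Complete I θ₁ := by
    have hlt : lpOpt I < ENNReal.ofReal (θ₁ * ((1 - 2 * (I.k : ℝ) / I.nW) * target I)) := by
      rw [ENNReal.lt_ofReal_iff_toReal_lt hfin]
      rwa [hθ, unitCostOf, div_lt_iff₀ hpos] at hθ₁
    obtain ⟨_, ⟨x, y, hxy, rfl⟩, hlt⟩ := sInf_lt_iff.mp hlt
    have := complete_of_feasible hk hn hxy (mul_pos (hθ0.trans_lt hθ₁) hpos) hlt.le
    rwa [unitCostOf, mul_div_cancel_right₀ _ hpos.ne'] at this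
  -- The cell just past the input is zero, which makes `0` a candidate; hence `e` ranges up to `nU *
  -- nW` inclusive.
  have hzero : unitCost I (I.nU * I.nW) 0 = 0 := by simp [unitCost, Instance.initState]
  have hne : (S.filter (· ≤ θ₁)).Nonempty :=
    ⟨0, Finset.mem_filter.mpr ⟨hzero ▸ hmem _ le_rfl 0 (levels_pos hk hn), hθ0.trans hθ₁.le⟩⟩
  obtain ⟨θ₂, hθ₂, hmax⟩ := Finset.exists_max_image _ id hne
  obtain ⟨hθ₂S, hθ₂le⟩ := Finset.mem_filter.mp hθ₂
  obtain ⟨⟨e, b⟩, heb, hθ₂eq⟩ := Finset.mem_image.mp hθ₂S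
  simp only [Finset.mem_product, Finset.mem_range] at heb
  dsimp only at hθ₂eq
  refine ⟨e, by omega, b, heb.2, ?_, ?_⟩
  · rw [hθ₂eq]; exact hS₁ _ hθ₂S hθ₂le
  · rw [hθ₂eq]
    refine hcomplete.congr fun i j a ha => and_congr_right fun hij => ⟨fun hc => ?_, fun hc => ?_⟩
    · rcases Nat.eq_zero_or_pos a with rfl | ha0
      · simpa using hc
      · have ha' : (0 : ℝ) < a := by exact_mod_cast ha0
        -- The threshold `c i j / a` has `b + 1 = a`. Level `0` needs no candidate, as its condition
        -- does not involve the unit cost.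
        have hcand : unitCost I (i * I.nW + j) (a - 1) = I.cost i j / a := by
          have h1 : (((a - 1 : ℕ) : ℝ) + 1) = a := by
            rw [Nat.cast_sub ha0]; simp
          rw [unitCost, h1, initState_real, if_pos hij]
        have hle : (I.cost i j : ℝ) / a ≤ θ₂ := by
          refine hmax _ (Finset.mem_filter.mpr ⟨?_, ?_⟩)
          · rw [← hcand]
            refine hmem _ ?_ _ (by omega)
            have h1 : (i + 1) * I.nW ≤ I.nU * I.nW := Nat.mul_le_mul_right _ i.2
            have h2 := j.2
            rw [add_mul, one_mul] at h1
            omega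
          · rw [div_le_iff₀ ha']; linarith
        rw [div_le_iff₀ ha'] at hle
        linarith
    · exact hc.trans (by gcongr)

/-- At the first covered level `a` some center has `c i j ≤ a θ`, which is scaled cost at most `a /
D`, and the `a` levels below are all uncovered. -/
theorem cappedCostAt_le {lam : ℝ} (C : Finset (Fin I.nU)) (j : Fin I.nW) :
    cappedCostAt I (ENNReal.ofReal lam) C j ≤
      ENNReal.ofReal ((uncovered I (unitCostOf I lam) C j).card / target I) := by
  classical
  have hD : (0 : ℝ) < target I := by exact_mod_cast target_pos hk hn
  have hα := one_sub_pos hk hn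
  by_cases hcov : ∃ a, a < levels I ∧ ∃ i ∈ C, Covers I (unitCostOf I lam) i j a
  · obtain ⟨ha, i, hi, hc⟩ := Nat.find_spec hcov
    set a := Nat.find hcov with hadef
    have hsub : Finset.range a ⊆ uncovered I (unitCostOf I lam) C j := by
      intro a' ha'
      rw [Finset.mem_range] at ha'
      refine Finset.mem_filter.mpr ⟨Finset.mem_range.mpr (by omega), fun i hi hc' => ?_⟩
      exact Nat.find_min hcov ha' ⟨by omega, i, hi, hc'⟩
    have hcard : a ≤ (uncovered I (unitCostOf I lam) C j).card := by
      simpa using Finset.card_le_card hsub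
    -- Multiplying out also handles `lam = 0`: the numerator must then vanish, and `0 / 0 = 0`.
    refine (min_le_right _ _).trans (ENNReal.div_le_of_le_mul ?_)
    calc ENNReal.ofReal (1 - 2 * (I.k : ℝ) / I.nW) * (⨅ i ∈ C, I.c i j)
        ≤ ENNReal.ofReal (1 - 2 * (I.k : ℝ) / I.nW) * I.c i j := by
          gcongr; exact iInf₂_le i hi
      _ = ENNReal.ofReal ((1 - 2 * (I.k : ℝ) / I.nW) * I.cost i j) := by
          rw [Instance.c, if_pos hc.1, ENNReal.ofReal_mul hα.le, ENNReal.ofReal_coe_nnreal]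
      _ ≤ ENNReal.ofReal (a / target I * lam) := by
          refine ENNReal.ofReal_le_ofReal ?_
          have h1 := mul_le_mul_of_nonneg_left hc.2 hα.le
          refine h1.trans_eq ?_
          unfold unitCostOf
          field_simp
      _ = ENNReal.ofReal (a / target I) * ENNReal.ofReal lam :=
          ENNReal.ofReal_mul (by positivity)
      _ ≤ _ := by gcongr
  -- With no level covered, the charge `levels / target` equals the cap.
  · push Not at hcov
    have hall : uncovered I (unitCostOf I lam) C j = Finset.range (levels I) :=
      Finset.filter_true_of_mem fun a ha => hcov a (Finset.mem_range.mp ha)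
    refine (min_le_left _ _).trans (ENNReal.ofReal_le_ofReal ?_)
    have hA : (0 : ℝ) < levels I := by exact_mod_cast levels_pos hk hn
    rw [hall, Finset.card_range, target]
    push_cast
    rw [div_mul_eq_div_div, div_self hA.ne']

theorem cappedCost_lt_one {lam : ℝ} {C : Finset (Fin I.nU)}
    (h : potential I (unitCostOf I lam) C < target I) :
    cappedCost I (ENNReal.ofReal lam) C < 1 := by
  have hD : (0 : ℝ) < target I := by exact_mod_cast target_pos hk hn
  calc cappedCost I (ENNReal.ofReal lam) C
      ≤ ∑ j, ENNReal.ofReal ((uncovered I (unitCostOf I lam) C j).card / target I) :=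
        Finset.sum_le_sum fun j _ => cappedCostAt_le hk hn C j
    _ = ENNReal.ofReal (potential I (unitCostOf I lam) C / target I) := by
        rw [← ENNReal.ofReal_sum_of_nonneg fun j _ => by positivity, ← Finset.sum_div,
          potential, Nat.cast_sum]
    _ < 1 := by
        rw [ENNReal.ofReal_lt_one, div_lt_one hD]
        exact_mod_cast h

omit hk hn in
theorem cappedCost_top (C : Finset (Fin I.nU)) :
    cappedCost I ⊤ C = 0 := by
  simp [cappedCost, cappedCostAt]

end Parameters

end KMedian

/-! ### The program. -/

namespace KMedian

open RAM

namespace Greedy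

/-! The arrays of naturals that the program uses besides the input; all but `out` and `cur` hold
one scalar variable. -/

abbrev out : ℕ := 2
abbrev vA : ℕ := 3
abbrev vD : ℕ := 4
abbrev ve : ℕ := 5
abbrev vb : ℕ := 6
abbrev vr : ℕ := 7
abbrev vu : ℕ := 8
abbrev vj : ℕ := 9
abbrev va : ℕ := 10
abbrev vi : ℕ := 11
abbrev flag : ℕ := 12
abbrev vpsi : ℕ := 13
abbrev prev : ℕ := 14
abbrev cur : ℕ := 15
abbrev bestE : ℕ := 16
abbrev bestB : ℕ := 17

abbrev kExp : IntExp := .get 0 (.const 0)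
abbrev nUExp : IntExp := .get 0 (.const 1)
abbrev nExp : IntExp := .get 0 (.const 2)

/-- Position of the pair `(i, j)` in the input arrays. -/
abbrev edgeExp : IntExp := .add (.mul (.var vi) nExp) (.var vj)

/-- Is cell `v` of the array `cur` equal to `1`? -/
def memTest (v : ℕ) : Test :=
  .and (.intLe (.const 1) (.get cur (.var v))) (.intLe (.get cur (.var v)) (.const 1))

/-- Does center `i` serve customer `j` at level `a`? -/
def coverTest : Test :=
  .and (.intLe (.const 1) (.get 1 edgeExp))
    (.realLe (.mul (.cast (.add (.var vb) (.const 1))) (.get 0 edgeExp))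
      (.mul (.cast (.var va)) (.get 0 (.var ve))))

/-- Set `flag` to `0` if and only if no current center serves customer `j` at level `a`. -/
def hitProg : Prog :=
  .seq (.setInt flag (.const 0) (.const 0))
    (.for vi nUExp (.ite (.and (memTest vi) coverTest)
      (.setInt flag (.const 0) (.const 1)) .skip))

/-- Add the number of uncovered levels of customer `j` to `vpsi`. -/
def levelsProg : Prog :=
  .for va (.var vA) (.seq hitProg (.ite (.intLe (.var flag) (.const 0))
    (.setInt vpsi (.const 0) (.add (.var vpsi) (.const 1))) .skip))

/-- Compute the potential of the current set of centers. -/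
def potentialProg : Prog :=
  .seq (.setInt vpsi (.const 0) (.const 0)) (.for vj nExp levelsProg)

/-- Was the last center added worthwhile? -/
def progressTest : Test :=
  .intLe
    (.add (.add (.mul (.mul nExp kExp) (.var vpsi)) (.mul nExp (.var prev)))
      (.mul (.mul (.const 2) kExp) (.var vD)))
    (.add (.add (.mul (.mul nExp kExp) (.var prev)) (.mul nExp (.var vD))) (.mul nExp nExp))

/-- Add center `u` provisionally, and remove it again unless it makes progress. -/
def addProg : Prog :=
  .seq (.setInt prev (.const 0) (.var vpsi))
    (.seq (.setInt cur (.var vu) (.const 1))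
      (.seq potentialProg (.ite progressTest .skip (.setInt cur (.var vu) (.const 0)))))

/-- One step of the greedy algorithm. -/
def stepProg : Prog :=
  .seq potentialProg
    (.ite (.and (.intLe (.var vD) (.var vpsi)) (.not (memTest vu))) addProg .skip)

def sweepProg : Prog := .for vu nUExp stepProg

/-- The greedy algorithm for one unit cost. -/
def greedyProg : Prog :=
  .seq (.for vi nUExp (.setInt cur (.var vi) (.const 0)))
    (.for vr (.mul nExp (.var vA)) sweepProg)

/-- Is the current set of centers better than the one stored in `out`? -/
def betterTest : Test :=
  .and (.not (.intLe (.var vD) (.var vpsi)))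
    (.realLe (.mul (.get 0 (.var ve)) (.cast (.var bestB)))
      (.mul (.get 0 (.var bestE)) (.cast (.add (.var vb) (.const 1)))))

/-- Copy the current set of centers to `out`. -/
def copyProg : Prog :=
  .for vi nUExp (.ite (memTest vi)
    (.setInt out (.var vi) (.const 1)) (.setInt out (.var vi) (.const 0)))

def keepProg : Prog :=
  .seq potentialProg (.ite betterTest
    (.seq (.setInt bestE (.const 0) (.var ve))
      (.seq (.setInt bestB (.const 0) (.add (.var vb) (.const 1))) copyProg))
    .skip)

def candidateProg : Prog := .seq greedyProg keepProg

def searchProg : Prog :=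
  .for ve (.add (.mul nUExp nExp) (.const 1)) (.for vb (.var vA) candidateProg)

def mainProg : Prog :=
  .seq (.setInt vA (.const 0) (.mul nExp (.mul nExp (.mul nExp (.mul nExp nExp)))))
    (.seq (.setInt vD (.const 0) (.mul (.var vA) (.add (.mul (.const 2) kExp) (.const 1))))
      searchProg)

/-! Bounds for the running times, in terms of a bound `V` for the numbers of iterations. -/

section Cost

variable {R : Type*} [CommSemiring R] (V : R)

def hitCost : R := (V + 1) * 80 + 10
def levelsCost : R := (V + 1) * (hitCost V + 40)
def potentialCost : R := (V + 1) * (levelsCost V + 20) + 10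
def stepCost : R := 2 * potentialCost V + 150
def sweepCost : R := (V + 1) * (stepCost V + 20)
def greedyCost : R := (V + 1) * (sweepCost V + 20) + (V + 1) * 20 + 5
def keepCost : R := potentialCost V + (V + 1) * 60 + 100
def searchCost : R := (V + 1) * ((V + 1) * (greedyCost V + keepCost V + 20) + 20)
def mainCost : R := searchCost V + 100

end Cost

/-- All the numbers of iterations and all the naturals stored are at most `V`. -/
structure Fits (I : Instance) (V : ℕ) : Prop where
  centers : I.nU ≤ V
  customers : I.nW ≤ V
  levels : levels I ≤ V
  pairs : I.nW * KMedian.levels I ≤ V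
  target : target I ≤ V
  edges : I.nU * I.nW + 1 ≤ V
  one : 1 ≤ V

/-- The memory holds the input and the constants of the program. -/
structure Ready (I : Instance) (s : State) : Prop where
  real : s.real = I.initState.real
  int_zero : s.int 0 = I.initState.int 0
  int_one : s.int 1 = I.initState.int 1
  levels : s.int vA 0 = levels I
  target : s.int vD 0 = target I

/-- The program is working on the unit cost given by `e` and `b`. -/
structure Working (I : Instance) (e b : ℕ) (s : State) : Prop extends Ready I s where
  e : s.int ve 0 = e
  b : s.int vb 0 = b

/-! ### Correctness and running time of the greedy subprograms. -/

section

variable {I : Instance} {V e b : ℕ} {s t : State} {l : List ℕ}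

theorem Ready.agree (h : Ready I s) (hst : Agree l s t) (hl : ∀ a ∈ [0, 1, vA, vD], a ∉ l) :
    Ready I t where
  real := by rw [hst.real, h.real]
  int_zero := by rw [hst.int 0 (hl _ (by simp)), h.int_zero]
  int_one := by rw [hst.int 1 (hl _ (by simp)), h.int_one]
  levels := by rw [hst.int vA (hl _ (by simp)), h.levels]
  target := by rw [hst.int vD (hl _ (by simp)), h.target]

theorem Working.agree (h : Working I e b s) (hst : Agree l s t)
    (hl : ∀ a ∈ [0, 1, vA, vD, ve, vb], a ∉ l) : Working I e b t where
  toReady := h.toReady.agree hst fun a ha => hl a (by simp at ha ⊢; tauto)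
  e := by rw [hst.int ve (hl _ (by simp)), h.e]
  b := by rw [hst.int vb (hl _ (by simp)), h.b]

theorem Ready.k (h : Ready I s) : s.int 0 0 = I.k := by simp [h.int_zero, Instance.initState]
theorem Ready.nU (h : Ready I s) : s.int 0 1 = I.nU := by simp [h.int_zero, Instance.initState]
theorem Ready.nW (h : Ready I s) : s.int 0 2 = I.nW := by simp [h.int_zero, Instance.initState]

variable (I) in
/-- The current set of centers. -/
def current (s : State) : Finset (Fin I.nU) :=
  Finset.univ.filter fun i => s.int cur i = 1

theorem current_congr (h : t.int cur = s.int cur) : current I t = current I s := by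
  simp [current, h]

theorem mem_current {i : Fin I.nU} : i ∈ current I s ↔ s.int cur i = 1 := by
  simp [current]

theorem memTest_eval (v : ℕ) : (memTest v).eval s ↔ s.int cur (s.int v 0) = 1 := by
  simp only [memTest, Test.eval, IntExp.eval]
  omega

/-- Multiplying `c i j ≤ a * unitCost` by the denominator `b + 1` lets the test use the input costs
directly, without storing the unit cost. -/
theorem coverTest_eval (h : Working I e b s) {i : Fin I.nU} {j : Fin I.nW} {a : ℕ}
    (hi : s.int vi 0 = i) (hj : s.int vj 0 = j) (ha : s.int va 0 = a) :
    coverTest.eval s ↔ Covers I (unitCost I e b) i j a := by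
  have hb : (0 : ℝ) < b + 1 := by positivity
  simp only [coverTest, Test.eval, IntExp.eval, RealExp.eval, hi, hj, ha, h.nW, h.e, h.b,
    h.real, h.int_one, initState_int_one, initState_real, Covers, unitCost]
  by_cases hij : (i, j) ∈ I.E
  · simp only [hij, if_true, le_refl, true_and]
    rw [← mul_div_assoc, le_div_iff₀ hb]
    push_cast
    rw [mul_comm (I.cost i j : ℝ)]
  · simp [hij]

theorem hitProg_runs (hV : Fits I V) (h : Working I e b s) {j : Fin I.nW} {a : ℕ}
    (hj : s.int vj 0 = j) (ha : s.int va 0 = a) :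
    Runs V hitProg s (hitCost V) fun t =>
      t.int flag 0 ≤ 0 ↔ ∀ i ∈ current I s, ¬ Covers I (unitCost I e b) i j a := by
  refine Runs.seq (K₁ := 5) (K₂ := (V + 1) * 80) (mid := fun t => t.int flag 0 = 0)
    (.setInt (by simp [IntExp.eval]) (by simp [IntExp.ops]) (State.int_writeInt_self _ _ _ _))
    (by simp only [hitCost]; omega) ?_
  intro t hst ht
  refine (Runs.for (K := 60) (B := I.nU) (fun m r => r.int flag 0 ≤ 0 ↔
      ∀ i : Fin I.nU, (i : ℕ) < m → i ∈ current I s → ¬ Covers I (unitCost I e b) i j a)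
    (by decide) (by simp [IntExp.ops]) hV.centers ?_ ?_ ?_).weaken le_rfl ?_
  · intro r hr
    exact ((h.agree hst (by decide)).agree hr (by decide)).nU
  · rw [State.int_writeInt_of_ne _ _ _ (by decide), ht]
    simp
  · intro m hm r hr hri hinv
    have hw := (h.agree hst (by decide)).agree hr (by decide)
    have hcur : r.int cur = s.int cur := by
      rw [hr.int _ (by decide), hst.int _ (by decide)]
    have hrj : r.int vj 0 = j := by rw [hr.int _ (by decide), hst.int _ (by decide), hj]
    have hra : r.int va 0 = a := by rw [hr.int _ (by decide), hst.int _ (by decide), ha]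
    have htest : (Test.and (memTest vi) coverTest).eval r ↔
        ((⟨m, hm⟩ : Fin I.nU) ∈ current I s ∧ Covers I (unitCost I e b) ⟨m, hm⟩ j a) := by
      rw [Test.eval, memTest_eval, coverTest_eval hw (i := ⟨m, hm⟩) hri hrj hra, mem_current,
        hcur, hri]
    have hstep : (∀ i : Fin I.nU, (i : ℕ) < m + 1 → i ∈ current I s →
        ¬ Covers I (unitCost I e b) i j a) ↔
        (∀ i : Fin I.nU, (i : ℕ) < m → i ∈ current I s → ¬ Covers I (unitCost I e b) i j a) ∧
        ¬ ((⟨m, hm⟩ : Fin I.nU) ∈ current I s ∧ Covers I (unitCost I e b) ⟨m, hm⟩ j a) := by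
      constructor
      · intro hall
        exact ⟨fun i hi => hall i (by omega), fun hc => hall ⟨m, hm⟩ (by simp) hc.1 hc.2⟩
      · rintro ⟨hall, hc⟩ i hi hic hcov
        rcases Nat.lt_succ_iff_lt_or_eq.mp hi with hi | hi
        · exact hall i hi hic hcov
        · have : i = ⟨m, hm⟩ := Fin.ext hi
          exact hc (this ▸ ⟨hic, hcov⟩)
    refine Runs.ite (K₁ := 3) (by simp [Test.ops, IntExp.ops, RealExp.ops, memTest, coverTest])
      (fun hb => ?_) (fun hb => ?_)
    · refine .setInt hV.one (by simp [IntExp.ops]) ?_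
      rw [State.int_writeInt_of_ne _ _ _ (by decide), hstep]
      simp [IntExp.eval, State.int_writeInt_self, htest.mp hb]
    · refine .skip (by simp) ?_
      rw [State.int_writeInt_of_ne _ _ _ (by decide), hstep, hinv]
      exact (and_iff_left (htest.not.mp hb)).symm
  · intro r _ hr
    exact hr.trans ⟨fun h' i => h' i i.2, fun h' i _ => h' i⟩

open Classical in
theorem levelsProg_runs (hV : Fits I V) (h : Working I e b s) {j : Fin I.nW}
    (hj : s.int vj 0 = j) (hpsi : s.int vpsi 0 ≤ j * levels I) :
    Runs V levelsProg s (levelsCost V) fun t =>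
      t.int vpsi 0 = s.int vpsi 0 + (uncovered I (unitCost I e b) (current I s) j).card := by
  refine Runs.for (K := hitCost V + 20) (B := levels I) (fun m r => r.int vpsi 0 =
      s.int vpsi 0 + ((Finset.range m).filter fun a =>
        ∀ i ∈ current I s, ¬ Covers I (unitCost I e b) i j a).card)
    (by decide) (by simp [IntExp.ops]) hV.levels ?_ ?_ ?_
  · intro r hr
    exact (h.agree hr (by decide)).levels
  · rw [State.int_writeInt_of_ne _ _ _ (by decide)]
    simp
  · intro m hm r hr hrm hinv
    have hw := h.agree hr (by decide)
    have hcur : current I r = current I s := current_congr (hr.int _ (by decide))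
    have hrj : r.int vj 0 = j := by rw [hr.int _ (by decide), hj]
    refine (hitProg_runs hV hw hrj hrm).seq (K₂ := 15) (by omega) ?_
    intro t hrt hflag
    have hpt : t.int vpsi 0 = r.int vpsi 0 := by rw [hrt.int _ (by decide)]
    rw [hcur] at hflag
    rw [Finset.range_add_one, Finset.filter_insert]
    refine Runs.ite (K₁ := 7) (by simp [Test.ops, IntExp.ops]) (fun hb => ?_) (fun hb => ?_)
    · have hb' := hflag.mp hb
      have hle : ((Finset.range m).filter fun a =>
          ∀ i ∈ current I s, ¬ Covers I (unitCost I e b) i j a).card ≤ m :=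
        (Finset.card_filter_le _ _).trans (by simp)
      -- Customers before `j` contribute at most `j * levels`, and `j` itself at most `levels`, so
      -- the counter never exceeds `n * levels`.
      have hlt : t.int vpsi 0 + 1 ≤ V := by
        have h1 : (j + 1) * levels I ≤ I.nW * levels I := Nat.mul_le_mul_right _ j.2
        have h2 := hV.pairs
        rw [add_one_mul] at h1
        omega
      refine .setInt (by simpa [IntExp.eval] using hlt) (by simp [IntExp.ops]) ?_
      rw [State.int_writeInt_of_ne _ _ _ (by decide), if_pos hb',
        Finset.card_insert_of_notMem (by simp)]
      simp only [IntExp.eval, State.int_writeInt_self]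
      omega
    · have hb' := hflag.not.mp hb
      refine .skip (by simp) ?_
      rw [State.int_writeInt_of_ne _ _ _ (by decide), if_neg hb', hpt, hinv]

theorem potentialProg_runs (hV : Fits I V) (h : Working I e b s) :
    Runs V potentialProg s (potentialCost V) fun t =>
      t.int vpsi 0 = potential I (unitCost I e b) (current I s) := by
  classical
  refine Runs.seq (K₁ := 5) (K₂ := (V + 1) * (levelsCost V + 20))
    (mid := fun t => t.int vpsi 0 = 0)
    (.setInt (by simp [IntExp.eval]) (by simp [IntExp.ops]) (State.int_writeInt_self _ _ _ _))
    (by simp only [potentialCost]; omega) ?_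
  intro t hst ht
  -- Extension by zero turns the sum over customers into partial sums indexed by the loop counter.
  set w : ℕ → ℕ := fun j => if hj : j < I.nW then
    (uncovered I (unitCost I e b) (current I s) ⟨j, hj⟩).card else 0 with hw
  have hwle : ∀ m, ∑ j ∈ Finset.range m, w j ≤ m * levels I := by
    intro m
    refine (Finset.sum_le_card_nsmul _ _ (levels I) fun j _ => ?_).trans (by simp)
    simp only [hw]
    split_ifs
    · exact (Finset.card_filter_le _ _).trans (by simp)
    · exact Nat.zero_le _
  refine (Runs.for (K := levelsCost V) (B := I.nW)
    (fun m r => r.int vpsi 0 = ∑ j ∈ Finset.range m, w j)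
    (by decide) (by simp [IntExp.ops]) hV.customers ?_ ?_ ?_).weaken le_rfl ?_
  · intro r hr
    exact ((h.agree hst (by decide)).agree hr (by decide)).nW
  · rw [State.int_writeInt_of_ne _ _ _ (by decide), ht]
    simp
  · intro m hm r hr hrm hinv
    have hwork := (h.agree hst (by decide)).agree hr (by decide)
    have hcur : current I r = current I s :=
      current_congr (by rw [hr.int _ (by decide), hst.int _ (by decide)])
    refine (levelsProg_runs hV hwork (j := ⟨m, hm⟩) hrm ?_).weaken le_rfl ?_
    · rw [hinv]; exact hwle m
    · intro t _ ht
      rw [State.int_writeInt_of_ne _ _ _ (by decide), ht, hinv, Finset.sum_range_succ, hcur]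
      simp [hw, hm]
  · intro r _ hr
    rw [hr, Finset.sum_range]
    simp [hw, potential]

theorem progressTest_eval (h : Ready I s) : progressTest.eval s ↔
    I.nW * I.k * s.int vpsi 0 + I.nW * s.int prev 0 + 2 * I.k * target I ≤
      I.nW * I.k * s.int prev 0 + I.nW * target I + I.nW * I.nW := by
  simp only [progressTest, Test.eval, IntExp.eval, h.nW, h.k, h.target]

/-- Undoing a failed trial would delete a center chosen earlier, so the program skips those; this
agrees with `greedyStep`, since inserting a member changes nothing. -/
theorem stepProg_runs (hV : Fits I V) (h : Working I e b s) {u : Fin I.nU}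
    (hu : s.int vu 0 = u) :
    Runs V stepProg s (stepCost V) fun t =>
      current I t = greedyStep I (unitCost I e b) (current I s) u := by
  refine (potentialProg_runs hV h).seq (K₂ := potentialCost V + 140)
    (by simp only [stepCost]; omega) ?_
  intro t hst ht
  have hwt := h.agree hst (by decide)
  have hcur : t.int cur = s.int cur := hst.int _ (by decide)
  have hut : t.int vu 0 = u := by rw [hst.int _ (by decide), hu]
  refine Runs.ite (K₁ := potentialCost V + 110)
    (by simp [Test.ops, IntExp.ops, memTest]; omega) (fun hb => ?_) (fun hb => ?_)
  · rw [Test.eval, Test.eval, Test.eval, memTest_eval, hut, hcur, ← mem_current (I := I)] at hb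
    simp only [IntExp.eval, hwt.target, ht] at hb
    obtain ⟨hD, hnot⟩ := hb
    have hpV : potential I (unitCost I e b) (current I s) ≤ V :=
      (potential_le _ _).trans hV.pairs
    refine Runs.seq (K₁ := 5) (K₂ := potentialCost V + 100) (mid := fun r => r.int prev 0 =
        potential I (unitCost I e b) (current I s))
      (.setInt (by simpa [IntExp.eval, ht] using hpV) (by simp [IntExp.ops])
        (by simp [IntExp.eval, State.int_writeInt_self, ht])) (by omega) ?_
    intro r htr hr
    have hwr := hwt.agree htr (by decide)
    have hcur' : r.int cur = s.int cur := by rw [htr.int _ (by decide), hcur]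
    have hur : r.int vu 0 = u := by rw [htr.int _ (by decide), hut]
    refine Runs.seq (K₁ := 5) (K₂ := potentialCost V + 90) (mid := fun r' => current I r' =
        insert u (current I s)) ?_ (by omega) ?_
    · refine .setInt hV.one (by simp [IntExp.ops]) ?_
      ext i
      simp only [IntExp.eval, mem_current, State.int_writeInt, hur, true_and, hcur',
        Finset.mem_insert, Fin.ext_iff]
      split_ifs with hi <;> simp [hi]
    intro r' hrr' hr'
    have hwr' := hwr.agree hrr' (by decide)
    refine (potentialProg_runs hV hwr').seq (K₂ := 80) (by omega) ?_
    intro z hz hzpsi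
    have hwz := hwr'.agree hz (by decide)
    have hzprev : z.int prev 0 = potential I (unitCost I e b) (current I s) := by
      rw [hz.int _ (by decide), hrr'.int _ (by decide), hr]
    have hzu : z.int vu 0 = u := by
      rw [hz.int _ (by decide), hrr'.int _ (by decide), hur]
    have hzcur : current I z = insert u (current I s) := by
      rw [current_congr (hz.int _ (by decide)), hr']
    have htest : progressTest.eval z ↔ Progress I (unitCost I e b) (current I s) u := by
      rw [progressTest_eval hwz.toReady, hzpsi, hzprev, hr', Progress]
    refine Runs.ite (K₁ := 5) (by simp [Test.ops, IntExp.ops, progressTest])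
      (fun hb => ?_) (fun hb => ?_)
    · refine .skip (by simp) ?_
      rw [greedyStep, if_pos ⟨hD, htest.mp hb⟩, hzcur]
    · refine .setInt (Nat.zero_le _) (by simp [IntExp.ops]) ?_
      rw [greedyStep, if_neg fun h' => hb (htest.mpr h'.2)]
      ext i
      simp only [IntExp.eval, mem_current, State.int_writeInt, hzu, true_and]
      split_ifs with hi
      · have : i = u := Fin.ext hi
        subst this
        simpa [mem_current] using hnot
      · rw [← mem_current (I := I), hzcur, Finset.mem_insert, Fin.ext_iff, or_iff_right hi,
          mem_current]
  · refine .skip (by omega) ?_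
    rw [current_congr hcur]
    unfold greedyStep
    split_ifs with h'
    · rw [Test.eval, Test.eval, Test.eval, memTest_eval, hut, hcur,
        ← mem_current (I := I)] at hb
      simp only [IntExp.eval, hwt.target, ht] at hb
      have : u ∈ current I s := by
        by_contra hc
        exact hb ⟨h'.1, hc⟩
      rw [Finset.insert_eq_of_mem this]
    · rfl

theorem sweepProg_runs (hV : Fits I V) (h : Working I e b s) :
    Runs V sweepProg s (sweepCost V) fun t =>
      current I t = sweep I (unitCost I e b) (current I s) I.nU := by
  refine Runs.for (K := stepCost V) (B := I.nU)
    (fun m r => current I r = sweep I (unitCost I e b) (current I s) m)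
    (by decide) (by simp [IntExp.ops]) hV.centers ?_ ?_ ?_
  · intro r hr
    exact (h.agree hr (by decide)).nU
  · exact current_congr (State.int_writeInt_of_ne _ _ _ (by decide))
  · intro m hm r hr hrm hinv
    refine (stepProg_runs hV (h.agree hr (by decide)) (u := ⟨m, hm⟩) hrm).weaken le_rfl ?_
    intro t _ ht
    rw [current_congr (State.int_writeInt_of_ne _ _ _ (by decide)), ht, hinv, sweep, dif_pos hm]

theorem greedyProg_runs (hV : Fits I V) (h : Working I e b s) :
    Runs V greedyProg s (greedyCost V) fun t =>
      current I t = greedySet I (unitCost I e b) := by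
  refine Runs.seq (K₁ := (V + 1) * 20) (K₂ := (V + 1) * (sweepCost V + 20))
    (mid := fun t => current I t = ∅) ?_ (by simp only [greedyCost]; omega) ?_
  · refine (Runs.for (K := 4) (B := I.nU) (fun m r => ∀ i < m, r.int cur i = 0)
      (by decide) (by simp [IntExp.ops]) hV.centers ?_ (by simp) ?_).weaken le_rfl ?_
    · intro r hr
      exact (h.agree hr (by decide)).nU
    · intro m hm r hr hrm hinv
      refine .setInt (Nat.zero_le _) (by simp [IntExp.ops]) ?_
      intro i hi
      rw [State.int_writeInt_of_ne _ _ _ (by decide), State.int_writeInt]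
      simp only [IntExp.eval, hrm, true_and]
      split_ifs with him
      · rfl
      · exact hinv i (by omega)
    · intro t _ ht
      ext i
      simp [mem_current, ht i i.2]
  · intro t hst ht
    refine Runs.for (K := sweepCost V) (B := I.nW * levels I)
      (fun m r => current I r = greedy I (unitCost I e b) m)
      (by decide) (by simp [IntExp.ops]) hV.pairs ?_ ?_ ?_
    · intro r hr
      have hw := (h.agree hst (by decide)).agree hr (by decide)
      simp [IntExp.eval, hw.nW, hw.levels]
    · rw [current_congr (State.int_writeInt_of_ne _ _ _ (by decide)), ht, greedy]
    · intro m hm r hr hrm hinv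
      have hw := (h.agree hst (by decide)).agree hr (by decide)
      refine (sweepProg_runs hV hw).weaken le_rfl ?_
      intro z _ hz
      rw [current_congr (State.int_writeInt_of_ne _ _ _ (by decide)), hz, hinv, greedy]

theorem output_congr (h : t.int out = s.int out) : I.output t = I.output s := by
  simp [Instance.output, h]

theorem copyProg_runs (hV : Fits I V) (h : Working I e b s) :
    Runs V copyProg s ((V + 1) * 60) fun t => I.output t = current I s := by
  refine (Runs.for (K := 20) (B := I.nU)
    (fun m r => ∀ i < m, r.int out i = 1 ↔ s.int cur i = 1)
    (by decide) (by simp [IntExp.ops]) hV.centers ?_ (by simp) ?_).weaken le_rfl ?_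
  · intro r hr
    exact (h.agree hr (by decide)).nU
  · intro m hm r hr hrm hinv
    have hcur : r.int cur = s.int cur := hr.int _ (by decide)
    refine Runs.ite (K₁ := 4) (by simp [Test.ops, IntExp.ops, memTest])
      (fun hb => .setInt hV.one (by simp [IntExp.ops]) ?_)
      (fun hb => .setInt (Nat.zero_le _) (by simp [IntExp.ops]) ?_)
    all_goals
      intro i hi
      rw [memTest_eval, hrm, hcur] at hb
      rw [State.int_writeInt_of_ne _ _ _ (by decide), State.int_writeInt]
      simp only [IntExp.eval, hrm, true_and]
      split_ifs with him
      · subst him; simp [hb]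
      · exact hinv i (by omega)
  · intro t _ ht
    ext i
    simp [mem_current, Instance.output, ht i i.2]

end

end Greedy

end KMedian

/-! ### The search for the least successful unit cost. -/

namespace KMedian

open RAM

theorem initState_real_nonneg (I : Instance) (e : ℕ) : 0 ≤ I.initState.real 0 e := by
  simp only [Instance.initState, if_true]
  split_ifs <;> positivity

namespace Greedy

/-- The unit cost of the set of centers stored in `out`. -/
noncomputable def bestCost (I : Instance) (s : State) : ℝ :=
  I.initState.real 0 (s.int bestE 0) / s.int bestB 0

/-- The array `out` holds a suitable set of centers for the least of the unit costs `(e, b)` with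
`P e b` for which the greedy algorithm succeeds, or the empty set if there are none. -/
structure Best (I : Instance) (P : ℕ → ℕ → Prop) (s : State) : Prop where
  spec : (s.int bestB 0 = 0 ∧ I.output s = ∅) ∨
    (0 < s.int bestB 0 ∧ (I.output s).card ≤ firstPhaseSize I ∧
      potential I (bestCost I s) (I.output s) < target I)
  least : ∀ e b, P e b → Complete I (unitCost I e b) →
    0 < s.int bestB 0 ∧ bestCost I s ≤ unitCost I e b

variable {I : Instance} {V e b : ℕ} {s t : State} {P P' : ℕ → ℕ → Prop}

theorem Best.congr (h : Best I P s) (hout : t.int out = s.int out)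
    (hE : t.int bestE = s.int bestE) (hB : t.int bestB = s.int bestB)
    (hP : ∀ e b, P' e b → P e b) : Best I P' t where
  spec := by
    simp only [bestCost, output_congr hout, hE, hB]
    exact h.spec
  least e b hp := by
    simp only [bestCost, hE, hB]
    exact h.least e b (hP e b hp)

/-- The ratios are compared by cross-multiplication. The denominator `bestB = 0` marks that nothing
is stored; the left side is then `0`, so any successful candidate is accepted. -/
theorem betterTest_eval (h : Working I e b s) : betterTest.eval s ↔
    s.int vpsi 0 < target I ∧ I.initState.real 0 e * s.int bestB 0 ≤
      I.initState.real 0 (s.int bestE 0) * (b + 1) := by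
  simp only [betterTest, Test.eval, IntExp.eval, RealExp.eval, h.target, h.real, h.e, h.b,
    not_le]
  push_cast
  rfl

section Parameters

variable (hk : 2 ≤ I.k) (hn : 3 * I.k ≤ I.nW)
include hk hn

/-- An accepted candidate has unit cost at most the stored one, so minimality is kept. For a
rejected complete candidate greedy succeeded, so the cost comparison failed and the stored unit cost
is smaller. -/
theorem keepProg_runs (hV : Fits I V) (h : Working I e b s) (he : e ≤ I.nU * I.nW)
    (hb : b < levels I) (hcur : current I s = greedySet I (unitCost I e b)) (hbest : Best I P s) :
    Runs V keepProg s (keepCost V) (Best I fun e' b' => P e' b' ∨ (e' = e ∧ b' = b)) := by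
  refine (potentialProg_runs hV h).seq (K₂ := (V + 1) * 60 + 90)
    (by simp only [keepCost]; omega) ?_
  intro t hst ht
  have hwt := h.agree hst (by decide)
  have hcurt : current I t = greedySet I (unitCost I e b) := by
    rw [current_congr (hst.int _ (by decide)), hcur]
  rw [hcur] at ht
  have hbt : Best I P t := hbest.congr (hst.int _ (by decide)) (hst.int _ (by decide))
    (hst.int _ (by decide)) fun _ _ => id
  have hb0 : (0 : ℝ) < b + 1 := by positivity
  refine Runs.ite (K₁ := (V + 1) * 60 + 20)
    (by simp [Test.ops, IntExp.ops, RealExp.ops, betterTest]; omega)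
    (fun hbet => ?_) (fun hbet => ?_)
  · rw [betterTest_eval hwt, ht] at hbet
    refine Runs.seq (K₁ := 5) (K₂ := (V + 1) * 60 + 10) (mid := fun r => r.int bestE 0 = e)
      (.setInt ?_ (by simp [IntExp.ops])
        (by simp [IntExp.eval, State.int_writeInt_self, hwt.e])) (by omega) ?_
    · have := hV.edges
      simp only [IntExp.eval, hwt.e]; omega
    intro r htr hr
    have hwr := hwt.agree htr (by decide)
    refine Runs.seq (K₁ := 6) (K₂ := (V + 1) * 60) (mid := fun r' => r'.int bestB 0 = b + 1)
      (.setInt ?_ (by simp [IntExp.ops])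
        (by simp [IntExp.eval, State.int_writeInt_self, hwr.b])) (by omega) ?_
    · have := hV.levels
      simp only [IntExp.eval, hwr.b]; omega
    intro r' hrr' hr'
    have hwr' := hwr.agree hrr' (by decide)
    refine (copyProg_runs hV hwr').weaken le_rfl ?_
    intro z hz hzout
    rw [current_congr (hrr'.int _ (by decide)), current_congr (htr.int _ (by decide)),
      hcurt] at hzout
    have hzB : z.int bestB 0 = b + 1 := by rw [hz.int _ (by decide), hr']
    have hzE : z.int bestE 0 = e := by
      rw [hz.int _ (by decide), hrr'.int _ (by decide), hr]
    have hcost : bestCost I z = unitCost I e b := by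
      simp [bestCost, unitCost, hzB, hzE]
    refine ⟨.inr ⟨by omega, ?_, ?_⟩, ?_⟩
    · rw [hzout]; exact card_greedySet_le hk hn _
    · rw [hzout, hcost]; exact hbet.1
    · rintro e' b' (hp | ⟨rfl, rfl⟩) hc
      · obtain ⟨hpos, hle⟩ := hbt.least e' b' hp hc
        refine ⟨by omega, le_trans ?_ hle⟩
        rw [hcost, unitCost, bestCost, div_le_div_iff₀ hb0 (by exact_mod_cast hpos)]
        exact hbet.2
      · exact ⟨by omega, hcost.le⟩
  · refine .skip (by omega) ⟨hbt.spec, ?_⟩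
    rintro e' b' (hp | ⟨rfl, rfl⟩) hc
    · exact hbt.least e' b' hp hc
    · rw [betterTest_eval hwt, ht, not_and, not_le] at hbet
      have hlt := hbet (hc.potential_greedySet_lt hk hn)
      have hpos : 0 < t.int bestB 0 := by
        by_contra hzero
        have hzero' : t.int bestB 0 = 0 := by omega
        rw [hzero', Nat.cast_zero, mul_zero] at hlt
        exact absurd hlt (not_lt.mpr (mul_nonneg (initState_real_nonneg I _) hb0.le))
      refine ⟨hpos, ?_⟩
      rw [bestCost, unitCost, div_le_div_iff₀ (by exact_mod_cast hpos) hb0]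
      exact hlt.le

theorem candidateProg_runs (hV : Fits I V) (h : Working I e b s) (he : e ≤ I.nU * I.nW)
    (hb : b < levels I) (hbest : Best I P s) :
    Runs V candidateProg s (greedyCost V + keepCost V + 1)
      (Best I fun e' b' => P e' b' ∨ (e' = e ∧ b' = b)) := by
  refine (greedyProg_runs hV h).seq le_rfl ?_
  intro t hst ht
  exact keepProg_runs hk hn hV (h.agree hst (by decide)) he hb ht
    (hbest.congr (hst.int _ (by decide)) (hst.int _ (by decide)) (hst.int _ (by decide))
      fun _ _ => id)

theorem searchProg_runs (hV : Fits I V) (h : Ready I s) (hbest : Best I (fun _ _ => False) s) :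
    Runs V searchProg s (searchCost V)
      (Best I fun e b => e < I.nU * I.nW + 1 ∧ b < levels I) := by
  refine Runs.for (K := (V + 1) * (greedyCost V + keepCost V + 20)) (B := I.nU * I.nW + 1)
    (fun m => Best I fun e b => e < m ∧ b < levels I)
    (by decide) (by simp [IntExp.ops]) hV.edges ?_ ?_ ?_
  · intro r hr
    have := h.agree hr (by decide)
    simp [IntExp.eval, this.nU, this.nW]
  · exact hbest.congr (State.int_writeInt_of_ne _ _ _ (by decide))
      (State.int_writeInt_of_ne _ _ _ (by decide)) (State.int_writeInt_of_ne _ _ _ (by decide))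
      (by simp)
  · intro m hm r hr hrm hinv
    have hready := h.agree hr (by decide)
    refine (Runs.for (K := greedyCost V + keepCost V + 1) (B := levels I)
      (fun m' => Best I fun e b => (e < m ∧ b < levels I) ∨ (e = m ∧ b < m'))
      (by decide) (by simp [IntExp.ops]) hV.levels ?_ ?_ ?_).weaken le_rfl ?_
    · intro z hz
      exact (hready.agree hz (by decide)).levels
    · exact hinv.congr (State.int_writeInt_of_ne _ _ _ (by decide))
        (State.int_writeInt_of_ne _ _ _ (by decide)) (State.int_writeInt_of_ne _ _ _ (by decide))
        (by simp)
    · intro m' hm' z hz hzm hinv'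
      have hwork : Working I m m' z :=
        ⟨hready.agree hz (by decide), by rw [hz.int _ (by decide), hrm], hzm⟩
      refine (candidateProg_runs hk hn hV hwork (by omega) hm' hinv').weaken le_rfl ?_
      intro w _ hw
      exact hw.congr (State.int_writeInt_of_ne _ _ _ (by decide))
        (State.int_writeInt_of_ne _ _ _ (by decide)) (State.int_writeInt_of_ne _ _ _ (by decide))
        (by intro e b; omega)
    · intro z _ hz
      exact hz.congr (State.int_writeInt_of_ne _ _ _ (by decide))
        (State.int_writeInt_of_ne _ _ _ (by decide)) (State.int_writeInt_of_ne _ _ _ (by decide))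
        (by intro e b; omega)

theorem mainProg_runs (hV : Fits I V) :
    Runs V mainProg I.initState (mainCost V)
      (Best I fun e b => e < I.nU * I.nW + 1 ∧ b < levels I) := by
  have hinit : ∀ a q, 2 ≤ a → I.initState.int a q = 0 := by
    intro a q ha
    have h0 : a ≠ 0 := by omega
    have h1 : a ≠ 1 := by omega
    simp [Instance.initState, h0, h1]
  have hk0 : I.initState.int 0 0 = I.k := by simp [Instance.initState]
  have hn0 : I.initState.int 0 2 = I.nW := by simp [Instance.initState]
  have hA : I.nW * (I.nW * (I.nW * (I.nW * I.nW))) = levels I := by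
    unfold levels; ring
  refine Runs.seq (K₁ := 40) (K₂ := searchCost V + 50) (mid := fun t => t.int vA 0 = levels I)
    (.setInt ?_ (by simp [IntExp.ops])
      (by simp [IntExp.eval, State.int_writeInt_self, hn0, hA]))
    (by simp only [mainCost]; omega) ?_
  · simpa only [IntExp.eval, hn0, hA] using hV.levels
  intro t hst ht
  have htk : t.int 0 0 = I.k := by rw [hst.int _ (by decide), hk0]
  have hD : levels I * (2 * I.k + 1) = target I := rfl
  refine Runs.seq (K₁ := 40) (K₂ := searchCost V) (mid := fun r => r.int vD 0 = target I)
    (.setInt ?_ (by simp [IntExp.ops])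
      (by simp [IntExp.eval, State.int_writeInt_self, htk, ht, hD])) (by omega) ?_
  · simpa only [IntExp.eval, htk, ht, hD] using hV.target
  intro r htr hr
  have hready : Ready I r :=
    { real := by rw [htr.real, hst.real]
      int_zero := by rw [htr.int _ (by decide), hst.int _ (by decide)]
      int_one := by rw [htr.int _ (by decide), hst.int _ (by decide)]
      levels := by rw [htr.int _ (by decide), ht]
      target := hr }
  refine searchProg_runs hk hn hV hready ⟨.inl ⟨?_, ?_⟩, by simp⟩
  · rw [htr.int _ (by decide), hst.int _ (by decide), hinit _ _ (by decide)]
  · have : r.int out = I.initState.int out := by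
      rw [htr.int _ (by decide), hst.int _ (by decide)]
    ext i
    simp [Instance.output, this, hinit]

-- Each of `n` and `2k + 1` is at most `m`, and `levels ≤ m^5`. The factor `2` absorbs the `+ 1` in
-- the number of candidate cells.
omit hk in
theorem fits : Fits I (2 * (I.nU + I.nW + 1) ^ 6) := by
  set m := I.nU + I.nW + 1 with hm
  have h1 : 1 ≤ m := by omega
  have h6 : m ≤ m ^ 6 := by simpa using Nat.pow_le_pow_right h1 (show 1 ≤ 6 by norm_num)
  have h2 : m ^ 2 ≤ m ^ 6 := Nat.pow_le_pow_right h1 (by norm_num)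
  have hA : levels I ≤ m ^ 5 := Nat.pow_le_pow_left (by omega) 5
  have h5 : m ^ 5 ≤ m ^ 6 := Nat.pow_le_pow_right h1 (by norm_num)
  have hprod : ∀ c ≤ m, c * levels I ≤ m ^ 6 := fun c hc =>
    (Nat.mul_le_mul hc hA).trans_eq (by ring)
  have hU : I.nU * I.nW ≤ m ^ 2 := by
    rw [sq]; exact Nat.mul_le_mul (by omega) (by omega)
  have hpair := hprod I.nW (by omega)
  have htarget := hprod (2 * I.k + 1) (by omega)
  refine ⟨by omega, by omega, by omega, by omega, ?_, by omega, by omega⟩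
  rw [target, mul_comm]
  omega

/-- For `λ* < ∞` the stored unit cost is at most that of a complete candidate, hence at most that of
`λ*`, and the potential is antitone. For `λ* = ∞` any set within the budget will do, including the
empty one. -/
theorem Best.suitable (h : Best I (fun e b => e < I.nU * I.nW + 1 ∧ b < levels I) s) :
    (I.output s).card ≤ firstPhaseSize I ∧
      cappedCost I (lpOpt I) (I.output s) < 1 := by
  constructor
  · rcases h.spec with ⟨-, h0⟩ | ⟨-, hc, -⟩
    · simp [h0]
    · exact hc
  · by_cases hfin : lpOpt I = ⊤
    · rw [hfin, cappedCost_top]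
      exact one_pos
    · obtain ⟨e, he, b, hb, hle, hc⟩ := exists_unitCost_complete hk hn hfin
      obtain ⟨hpos, hbest⟩ := h.least e b ⟨by omega, hb⟩ hc
      obtain ⟨-, -, hpot⟩ := h.spec.resolve_left fun h0 => by omega
      rw [← ENNReal.ofReal_toReal hfin]
      exact cappedCost_lt_one hk hn
        ((potential_anti_right (hbest.trans hle) _).trans_lt hpot)

end Parameters

/-- The polynomial that bounds the number of iterations of each loop. -/
noncomputable def sizePolynomial : Polynomial ℕ := 2 * (Polynomial.X + 1) ^ 6

/-- The cost bounds make sense in any commutative semiring, so the same expression serves as a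
number and as a polynomial. -/
theorem eval_mainCost (m : ℕ) : (mainCost sizePolynomial).eval m = mainCost (2 * (m + 1) ^ 6) := by
  simp [mainCost, searchCost, greedyCost, keepCost, sweepCost, stepCost, potentialCost,
    levelsCost, hitCost, sizePolynomial]

end Greedy

end KMedian

theorem mainTheorem5 :
    KMedian.ComputableInPolyTime
      (fun I => 2 ≤ I.k ∧ 3 * I.k ≤ I.nW)
      (fun I C => C.card ≤ KMedian.firstPhaseSize I ∧
        KMedian.cappedCost I (KMedian.lpOpt I) C < 1) := by
  -- The first summand bounds the time; the second bounds the stored naturals themselves and so,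
  -- crudely, their bit lengths.
  refine ⟨KMedian.Greedy.mainProg, KMedian.Greedy.mainCost KMedian.Greedy.sizePolynomial +
    KMedian.Greedy.sizePolynomial, fun I ⟨hk, hn⟩ => ?_⟩
  obtain ⟨t, N, hexec, hN, hbest⟩ := KMedian.Greedy.mainProg_runs hk hn (KMedian.Greedy.fits hn)
  refine ⟨t, N, hexec.mono (fun v hv => ?_) fun _ h => h.elim, ?_, hbest.suitable hk hn,
    fun L _ => hexec.mono (fun _ _ => trivial) fun _ h => h.elim⟩
  · have hsize : v.size ≤ v := Nat.size_le.mpr Nat.lt_two_pow_self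
    rw [Polynomial.eval_add]
    refine hsize.trans (hv.trans ((le_of_eq ?_).trans (Nat.le_add_left _ _)))
    simp [KMedian.Greedy.sizePolynomial]
  · rw [Polynomial.eval_add, KMedian.Greedy.eval_mainCost]
    exact hN.trans (Nat.le_add_right _ _)
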